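/- Let $\mathfrak g$ be a finite-dimensional simple complex Lie algebra of rank $n$ with Cartan subalgebra $\mathfrak h$, simple roots $\alpha_1,\dots,\alpha_n$, and a Chevalley basis $\{x_\alpha^{\pm}, h_i : \alpha \text{ a positive root},\ 1\le i\le n\}$, with $h_\alpha=[x_\alpha^+,x_\alpha^-]$ and $h_i=h_{\alpha_i}$. Let $A$ be a commutative associative unital $\mathbb C$-algebra with a $\mathbb C$-basis $\mathbf B$ that is closed under multiplication, and let $\mathfrak g\otimes A$ be the Lie algebra with bracket $[z\otimes a,z'\otimes b]=[z,z']\otimes ab$, with universal enveloping algebra $U(\mathfrak g\otimes A)$. For a set $S$ let $\mathcal F(S)$ be the set of finitely supported functions $\chi:S\to\mathbb Z_{\ge0}$ (finite multisets), with pointwise addition and pointwise order; regard $\mathcal F(\mathbf B)\subset\mathcal F(A)$ by extension by zero. Put $|\chi|=\sum_s\chi(s)$, and for $\psi\in\mathcal F(A)$ put $\pi(\psi)=\prod_{a}a^{\psi(a)}$ and $m(\psi)=|\psi|!/\prod_a\psi(a)!$. With $\{x^-,h,x^+\}$ the standard basis of $\mathfrak{sl}_2$, define $p(\varphi,\chi)\in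 U(\mathfrak{sl}_2\otimes A)$ for $\varphi,\chi\in\mathcal F(A)$ recursively by $p(0,0)=1$, $p(\varphi,\chi)=0$ if $|\varphi|\ne|\chi|$, and, if $|\varphi|=|\chi|>0$, $$p(\varphi,\chi)=-\frac{1}{|\varphi|}\sum_{0\ne\psi_1\le\varphi}\ \sum_{0\ne\psi_2\le\chi}m(\psi_1)\,m(\psi_2)\,\bigl(h\otimes\pi(\psi_1)\pi(\psi_2)\bigr)\,p(\varphi-\psi_1,\chi-\psi_2).$$ Put $p(\chi)=p(\chi,|\chi|\chi_1)$, where $\chi_1\in\mathcal F(A)$ is the characteristic function of $1\in A$, and let $p_i(\chi)\in U(\mathfrak g\otimes A)$ be the image of $p(\chi)$ under the algebra homomorphism $U(\mathfrak{sl}_2\otimes A)\to U(\mathfrak g\otimes A)$ with $x^\pm\otimes a\mapsto x^\pm_{\alpha_i}\otimes a$ and $h\otimes a\mapsto h_i\otimes a$. Let $U^0_{\mathbb Z}(\mathfrak g\otimes A)$ be the $\mathbb Z$-subalgebra of $U(\mathfrak g\otimes A)$ generated by all $p_i(\chi)$ with $1\le i\le n$ and $\chi\in\mathcal F(\mathbf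 B)$. **Lemma.** The ordered products $p_1(\psi_1)p_2(\psi_2)\cdots p_n(\psi_n)$, indexed by $(\psi_1,\dots,\psi_n)\in\mathcal F(\mathbf B)^n$, form a $\mathbb Z$-basis $\mathcal B_0$ of $U^0_{\mathbb Z}(\mathfrak g\otimes A)$. -/

import Mathlib

open scoped TensorProduct

noncomputable section

namespace MapAlgebra

attribute [local instance 100] LieRing.ofAssociativeRing

/-! ### Map algebras and multisets -/

/-- The element `z ⊗ a` of the map algebra `𝔞 ⊗ A`, viewed in the universal enveloping algebra
of `𝔞 ⊗ A`.  The map algebra is Mathlib's complex Lie algebra `A ⊗[ℂ] 𝔞`, with bracket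
`[a ⊗ z, b ⊗ z'] = ab ⊗ [z, z']`. -/
def elt {A 𝔞 : Type*} [CommRing A] [Algebra ℂ A] [LieRing 𝔞] [LieAlgebra ℂ 𝔞] (z : 𝔞) (a : A) :
    UniversalEnvelopingAlgebra ℂ (A ⊗[ℂ] 𝔞) :=
  UniversalEnvelopingAlgebra.ι ℂ (a ⊗ₜ[ℂ] z)

/-- `π(ψ) = ∏ a ^ ψ(a)` for a finite multiset `ψ` of elements of `A`. -/
def mprod {A : Type*} [CommRing A] (ψ : A →₀ ℕ) : A :=
  ψ.prod fun a k => a ^ k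

/-! ### The elements `p(φ, χ)` and `p(χ)` for `sl₂` -/

/-- The complex Lie algebra `sl₂`. -/
abbrev sl2 := LieAlgebra.SpecialLinear.sl (Fin 2) ℂ

/-- The element `h = diag(1, -1)` of `sl₂`. -/
def sl2h : sl2 := LieAlgebra.SpecialLinear.singleSubSingle 0 1 1

open Classical in
/-- The elements `p(φ, χ)` of `U(sl₂ ⊗ A)`: `p(0, 0) = 1`, `p(φ, χ) = 0` if `|φ| ≠ |χ|`, and
`p(φ, χ) = -(1/|φ|) ∑ m(ψ₁) m(ψ₂) (h ⊗ π(ψ₁) π(ψ₂)) p(φ - ψ₁, χ - ψ₂)` otherwise, where `ψ₁` and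
`ψ₂` run over the nonzero submultisets of `φ` and of `χ`. -/
def p2 {A : Type*} [CommRing A] [Algebra ℂ A] (φ χ : A →₀ ℕ) :
    UniversalEnvelopingAlgebra ℂ (A ⊗[ℂ] sl2) :=
  if φ = 0 ∧ χ = 0 then 1
  else if φ.degree = χ.degree then
    (-(φ.degree : ℂ)⁻¹) •
      ∑ ψ₁ ∈ ((Finset.Icc 0 φ).erase 0).attach, ∑ ψ₂ ∈ (Finset.Icc 0 χ).erase 0,
        ((ψ₁.1.multinomial : ℂ) * (ψ₂.multinomial : ℂ)) •
          (elt sl2h (mprod ψ₁.1 * mprod ψ₂) * p2 (φ - ψ₁.1) (χ - ψ₂))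
  else 0
termination_by φ.degree
decreasing_by
  have h := ψ₁.2
  rw [Finset.mem_erase, Finset.mem_Icc] at h
  have h1 : (φ - ψ₁.1) + ψ₁.1 = φ := tsub_add_cancel_of_le h.2.2
  have h2 : (φ - ψ₁.1).degree + ψ₁.1.degree = φ.degree := by rw [← map_add, h1]
  have h3 : ψ₁.1.degree ≠ 0 := fun h0 => h.1 ((Finsupp.degree_eq_zero_iff _).1 h0)
  omega

/-- `p(χ) = p(χ, |χ| χ₁)`, where `χ₁` is the characteristic function of `1 ∈ A`. -/
def p1 {A : Type*} [CommRing A] [Algebra ℂ A] (χ : A →₀ ℕ) :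
    UniversalEnvelopingAlgebra ℂ (A ⊗[ℂ] sl2) :=
  p2 χ (Finsupp.single 1 χ.degree)

/-! ### Homomorphisms out of `sl₂ ⊗ A` -/

/-- The Lie algebra homomorphism `sl₂ → 𝔤` attached to an `sl₂`-triple `(h, e, f)` of `𝔤`:
it maps the standard basis elements `h, x⁺, x⁻` of `sl₂` to `h, e, f`. -/
def sl2Hom {𝔤 : Type*} [LieRing 𝔤] [LieAlgebra ℂ 𝔤] {h e f : 𝔤} (t : IsSl2Triple h e f) :
    sl2 →ₗ⁅ℂ⁆ 𝔤 where
  toFun M := M.1 0 0 • h + M.1 0 1 • e + M.1 1 0 • f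
  map_add' M N := by
    have h0 : ∀ i j, (M + N).1 i j = M.1 i j + N.1 i j := fun _ _ => rfl
    simp only [h0]
    module
  map_smul' c M := by
    have h0 : ∀ i j, (c • M).1 i j = c * M.1 i j := fun _ _ => rfl
    simp only [h0, RingHom.id_apply]
    module
  map_lie' {M N} := by
    have hM : M.1 1 1 = - M.1 0 0 := by
      have := M.2
      change Matrix.trace M.1 = 0 at this
      rw [Matrix.trace_fin_two] at this
      linear_combination this
    have hN : N.1 1 1 = - N.1 0 0 := by
      have := N.2
      change Matrix.trace N.1 = 0 at this
      rw [Matrix.trace_fin_two] at this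
      linear_combination this
    have hfe : ⁅f, e⁆ = -h := by rw [← lie_skew, t.lie_e_f]
    have heh : ⁅e, h⁆ = -((2 : ℂ) • e) := by rw [← lie_skew, t.lie_h_e_smul ℂ]
    have hfh : ⁅f, h⁆ = (2 : ℂ) • f := by rw [← lie_skew, t.lie_lie_smul_f ℂ, neg_neg]
    simp only [LieAlgebra.SpecialLinear.sl_bracket, Matrix.sub_apply, Matrix.mul_apply,
      Fin.sum_univ_two, hM, hN, add_lie, lie_add, smul_lie, lie_smul, lie_self,
      t.lie_e_f, hfe, heh, hfh, t.lie_h_e_smul ℂ, t.lie_lie_smul_f ℂ]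
    module

/-- The algebra homomorphism `U(sl₂ ⊗ A) → U(𝔤 ⊗ A)` attached to an `sl₂`-triple `(h, e, f)` of
`𝔤`, with `h ⊗ a ↦ h ⊗ a`, `x⁺ ⊗ a ↦ e ⊗ a` and `x⁻ ⊗ a ↦ f ⊗ a`. -/
def omegaOfTriple (A : Type*) [CommRing A] [Algebra ℂ A] {𝔤 : Type*} [LieRing 𝔤] [LieAlgebra ℂ 𝔤]
    {h e f : 𝔤} (t : IsSl2Triple h e f) :
    UniversalEnvelopingAlgebra ℂ (A ⊗[ℂ] sl2) →ₐ[ℂ] UniversalEnvelopingAlgebra ℂ (A ⊗[ℂ] 𝔤) :=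
  UniversalEnvelopingAlgebra.lift ℂ
    ((UniversalEnvelopingAlgebra.ι ℂ).comp
      (LieAlgebra.ExtendScalars.map (AlgHom.id ℂ A) (sl2Hom t)))

/-! ### Chevalley bases -/

section Chevalley

open LieAlgebra LieAlgebra.IsKilling LieModule

variable {𝔤 : Type*} [LieRing 𝔤] [LieAlgebra ℂ 𝔤] [FiniteDimensional ℂ 𝔤] [IsSimple ℂ 𝔤]
  {H : LieSubalgebra ℂ 𝔤} [H.IsCartanSubalgebra]

/-- The root `-α`. -/
def negRoot (α : H.root) : H.root :=
  ⟨-α.1, by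
    have h := α.2
    simp only [LieSubalgebra.root, Finset.mem_filter, Finset.mem_univ, true_and] at h ⊢
    exact h.neg⟩

/-- Root vectors `x α` of a Chevalley basis of `𝔤` with respect to the Cartan subalgebra `H`:
`[x α, x (-α)]` is the coroot `h_α`, and `[x α, x β] = c • x (α + β)` implies
`[x (-α), x (-β)] = -c • x (-(α + β))` whenever `α`, `β`, `α + β` are roots.  Together with the
coroots `h_i` of a system of simple roots they form the Chevalley basis; for a positive root `α`,
`x α` and `x (-α)` are also written `x_α⁺` and `x_α⁻`. -/
structure IsChevalleyBasis (x : H.root → 𝔤) : Prop where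
  mem_rootSpace : ∀ α : H.root, x α ∈ rootSpace H (α.1 : H → ℂ)
  lie_neg : ∀ α : H.root, ⁅x α, x (negRoot α)⁆ = (coroot α.1 : H)
  lie_add : ∀ (α β γ : H.root), (γ.1 : H → ℂ) = (α.1 : H → ℂ) + (β.1 : H → ℂ) →
    ∀ c : ℂ, ⁅x α, x β⁆ = c • x γ →
      ⁅x (negRoot α), x (negRoot β)⁆ = -c • x (negRoot γ)

theorem IsChevalleyBasis.isSl2Triple {x : H.root → 𝔤} (hx : IsChevalleyBasis x) (α : H.root) :
    IsSl2Triple ((coroot α.1 : H) : 𝔤) (x α) (x (negRoot α)) := by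
  have hα : α.1.IsNonZero := LieSubalgebra.isNonZero_coe_root α
  have h2 : α.1 (coroot α.1) = 2 := root_apply_coroot hα
  refine ⟨?_, hx.lie_neg α, ?_, ?_⟩
  · intro h0
    exact hα (coroot_eq_zero_iff.1 (Subtype.ext h0))
  · have h := lie_eq_smul_of_mem_rootSpace (hx.mem_rootSpace α) (coroot α.1)
    rw [h2] at h
    rw [← Nat.cast_smul_eq_nsmul ℂ]
    exact_mod_cast h
  · have h := lie_eq_smul_of_mem_rootSpace (hx.mem_rootSpace (negRoot α)) (coroot α.1)
    have h3 : (negRoot α).1 (coroot α.1) = -2 := by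
      change -(α.1 (coroot α.1)) = -2
      rw [h2]
    rw [h3] at h
    rw [← Nat.cast_smul_eq_nsmul ℂ, ← neg_smul]
    exact_mod_cast h

/-- The homomorphism `Ω_α : U(sl₂ ⊗ A) → U(𝔤 ⊗ A)`, with `x^± ⊗ a ↦ x_α^± ⊗ a` and
`h ⊗ a ↦ h_α ⊗ a`. -/
def omega (A : Type*) [CommRing A] [Algebra ℂ A] {x : H.root → 𝔤} (hx : IsChevalleyBasis x)
    (α : H.root) :
    UniversalEnvelopingAlgebra ℂ (A ⊗[ℂ] sl2) →ₐ[ℂ] UniversalEnvelopingAlgebra ℂ (A ⊗[ℂ] 𝔤) :=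
  omegaOfTriple A (hx.isSl2Triple α)

/-- `p_α(χ) = Ω_α(p(χ))`. -/
def pRoot {A : Type*} [CommRing A] [Algebra ℂ A] {x : H.root → 𝔤} (hx : IsChevalleyBasis x)
    (α : H.root) (χ : A →₀ ℕ) : UniversalEnvelopingAlgebra ℂ (A ⊗[ℂ] 𝔤) :=
  omega A hx α (p1 χ)

/-- A finite multiset of elements of a subset `B` of `A`, regarded as a finite multiset of
elements of `A`. -/
def toA {A : Type*} {B : Set A} (χ : B →₀ ℕ) : A →₀ ℕ :=
  χ.embDomain (Function.Embedding.subtype _)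

/-- `f⁰(ψ₁, …, ψₙ) = p₁(ψ₁) p₂(ψ₂) ⋯ pₙ(ψₙ)`, where `p_i = p_{α_i}` for the roots
`α₁, …, αₙ`. -/
def f0 {A : Type*} [CommRing A] [Algebra ℂ A] {x : H.root → 𝔤} (hx : IsChevalleyBasis x)
    {n : ℕ} (α : Fin n → H.root) (B : Set A) (ψ : Fin n → (B →₀ ℕ)) :
    UniversalEnvelopingAlgebra ℂ (A ⊗[ℂ] 𝔤) :=
  (List.ofFn fun i => pRoot hx (α i) (toA (ψ i))).prod

/-- `U⁰_ℤ(𝔤 ⊗ A)`: the `ℤ`-subalgebra generated by all `p_i(χ)`, where `p_i = p_{α_i}` for the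
roots `α₁, …, αₙ` and `χ` runs over the finite multisets of elements of `B`. -/
def UZero {A : Type*} [CommRing A] [Algebra ℂ A] {x : H.root → 𝔤} (hx : IsChevalleyBasis x)
    {n : ℕ} (α : Fin n → H.root) (B : Set A) :
    Subalgebra ℤ (UniversalEnvelopingAlgebra ℂ (A ⊗[ℂ] 𝔤)) :=
  Algebra.adjoin ℤ {u | ∃ (i : Fin n) (χ : B →₀ ℕ), u = pRoot hx (α i) (toA χ)}

end Chevalley

end MapAlgebra

end

open scoped TensorProduct

noncomputable section

namespace MapAlgebra

attribute [local instance 100] LieRing.ofAssociativeRing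

section Auxiliary

open scoped Classical
open Finset.HasAntidiagonal (antidiagonal mem_antidiagonal)

/-! ### Multinomial coefficients -/

section Multinomial

variable {σ : Type*}

/-! For one simple root, put P = ∑ p_i(χ) t^χ and let E be the Euler operator in the t's. The
recursion says E P = -c P with c = ∑ m(ψ) (h_i ⊗ π(ψ)) t^ψ over ψ ≠ 0, so P is a formal exponential
in the commuting elements h_i ⊗ b, b ∈ B. Everything is therefore modelled on a polynomial ring with
one variable X_b per b ∈ B and a universal family `univP`; `IsExpFamily.unique` transports results
from there to the enveloping algebra.

The leading term of `univP χ` is a nonzero multiple of X^χ (`sameLeading_univP`), so the `univP χ`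
form a complex basis. The main point is that their integral span is closed under multiplication.
Substitute X_b + e_b for X_b, where the e_b multiply as the elements of B do. This adds the
geometric series u/(1 - u), u = ∑ e_b t_b, to c, and so multiplies P by 1 - u (`IsExpFamily.shift`,
`letterShift_univP`). Hence taking the coefficient of e_b removes one b from χ, up to sign. These
operators and evaluation at X = 0 read off all coordinates in the basis, and induction on degree
gives `univP_mul_univP_mem`. Taking products over the n simple roots yields `adjoin_colourP_eq_span`
and `linearIndependent_colourProd`.

It remains to see that X_(i,b) ↦ h_i ⊗ b is injective into the enveloping algebra. Instead of PBW, L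
= 𝔤 ⊗ A acts on its symmetric algebra by the adjoint derivation of z plus multiplication by ⁅z, w⁆.
Applied to 1, a product of elements z_s has leading term ∏ ⁅z_s, w⁆, so independence of the ⁅z_s, w⁆
suffices (`injective_of_linearIndependent_lie`). With w = 1 ⊗ ∑ x_β over the simple roots β,
independence holds because the simple roots span the dual of the Cartan subalgebra. -/

theorem multinomial_mul_prod_factorial (ψ : σ →₀ ℕ) :
    ψ.multinomial * ψ.prod (fun _ k => k.factorial) = ψ.degree.factorial := by
  rw [mul_comm, Finsupp.multinomial_eq, Finsupp.prod, Nat.multinomial_spec, Finsupp.degree_apply]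

theorem prod_factorial_pos (ψ : σ →₀ ℕ) : 0 < ψ.prod (fun _ k => k.factorial) :=
  Finset.prod_pos fun _ _ => Nat.factorial_pos _

theorem sub_single_add_single {ψ : σ →₀ ℕ} {b : σ} (hb : b ∈ ψ.support) :
    ψ - Finsupp.single b 1 + Finsupp.single b 1 = ψ :=
  tsub_add_cancel_of_le
    (Finsupp.single_le_iff.2 (Nat.one_le_iff_ne_zero.2 (Finsupp.mem_support_iff.1 hb)))

theorem degree_sub_single_add_one {ψ : σ →₀ ℕ} {b : σ} (hb : b ∈ ψ.support) :
    (ψ - Finsupp.single b 1).degree + 1 = ψ.degree := by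
  conv_rhs => rw [← sub_single_add_single hb, map_add, Finsupp.degree_single]

theorem prod_factorial_sub_single {ψ : σ →₀ ℕ} {b : σ} (hb : b ∈ ψ.support) :
    (ψ - Finsupp.single b 1).prod (fun _ k => k.factorial) * ψ b =
      ψ.prod (fun _ k => k.factorial) := by
  have h0 : ψ b ≠ 0 := Finsupp.mem_support_iff.1 hb
  rw [Finsupp.prod_of_support_subset (ψ - Finsupp.single b 1) Finsupp.support_tsub
    (fun _ k => k.factorial) (by simp),
    Finsupp.prod, ← Finset.mul_prod_erase _ _ hb, ← Finset.mul_prod_erase _ _ hb]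
  have h1 : ∀ a ∈ ψ.support.erase b,
      ((ψ - Finsupp.single b 1 : σ →₀ ℕ) a).factorial = (ψ a).factorial := by
    intro a ha
    have : b ≠ a := (Finset.ne_of_mem_erase ha).symm
    simp [this]
  rw [Finset.prod_congr rfl h1]
  have h2 : (ψ - Finsupp.single b 1 : σ →₀ ℕ) b = ψ b - 1 := by simp
  rw [h2, mul_right_comm, mul_comm _ (ψ b), Nat.mul_factorial_pred h0]

/-- Pascal's rule for multinomial coefficients. -/
theorem multinomial_eq_sum_sub_single {ψ : σ →₀ ℕ} (hψ : ψ ≠ 0) :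
    ψ.multinomial = ∑ b ∈ ψ.support, (ψ - Finsupp.single b 1).multinomial := by
  apply Nat.eq_of_mul_eq_mul_right (prod_factorial_pos ψ)
  have hd : ψ.degree ≠ 0 := fun h => hψ ((Finsupp.degree_eq_zero_iff _).1 h)
  rw [multinomial_mul_prod_factorial, Finset.sum_mul, ← Nat.mul_factorial_pred hd]
  have h : ∀ b ∈ ψ.support, (ψ - Finsupp.single b 1).multinomial *
      ψ.prod (fun _ k => k.factorial) = ψ b * (ψ.degree - 1).factorial := by
    intro b hb
    rw [← prod_factorial_sub_single hb, ← mul_assoc, multinomial_mul_prod_factorial, mul_comm,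
      ← degree_sub_single_add_one hb, Nat.add_sub_cancel]
  rw [Finset.sum_congr rfl h, ← Finset.sum_mul, Finsupp.degree_apply]

theorem exists_single_of_degree_eq_one {ψ : σ →₀ ℕ} (h : ψ.degree = 1) :
    ∃ b, ψ = Finsupp.single b 1 := by
  have h0 : ψ ≠ 0 := by rintro rfl; simp at h
  obtain ⟨b, hb⟩ := Finsupp.support_nonempty_iff.2 h0
  refine ⟨b, ?_⟩
  have h1 := degree_sub_single_add_one hb
  rw [h, Nat.add_eq_right, Finsupp.degree_eq_zero_iff] at h1
  rw [← sub_single_add_single hb, h1, zero_add]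

/-- Isolates the linear part of a convolution. It serves both for multiplication by the linear form
u and for the leading term of an exponential family. -/
theorem sum_antidiagonal_degree_eq_one {S : Type*} [AddCommMonoid S] (χ : σ →₀ ℕ)
    (f : (σ →₀ ℕ) → (σ →₀ ℕ) → S) :
    ∑ x ∈ antidiagonal χ, (if x.1.degree = 1 then f x.1 x.2 else 0) =
      ∑ b ∈ χ.support, f (Finsupp.single b 1) (χ - Finsupp.single b 1) := by
  rw [← Finset.sum_filter]
  symm
  refine Finset.sum_bij (fun b _ => (Finsupp.single b 1, χ - Finsupp.single b 1)) ?_ ?_ ?_ ?_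
  · intro b hb
    simp only [Finset.mem_filter, mem_antidiagonal, Finsupp.degree_single, and_true]
    rw [add_comm, sub_single_add_single hb]
  · intro a _ b _ h
    exact Finsupp.single_left_injective one_ne_zero (Prod.ext_iff.1 h).1
  · rintro ⟨ψ, ρ⟩ h
    simp only [Finset.mem_filter, mem_antidiagonal] at h
    obtain ⟨rfl, h1⟩ := h
    obtain ⟨b, rfl⟩ := exists_single_of_degree_eq_one h1
    exact ⟨b, by simp, by simp⟩
  · intros; rfl

end Multinomial

/-! ### Families defined by the exponential recursion -/

section Recursion

variable {σ S : Type*} [Ring S] [Algebra ℂ S]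

/-- The family `P` is the solution of `P(0) = 1` and `|χ| P(χ) = -∑ c(ψ) P(χ - ψ)`. -/
structure IsExpFamily (c P : (σ →₀ ℕ) → S) : Prop where
  zero : P 0 = 1
  degree_smul : ∀ χ, (χ.degree : ℂ) • P χ = -∑ x ∈ antidiagonal χ, c x.1 * P x.2

theorem degree_lt_of_mem_antidiagonal {χ : σ →₀ ℕ} {x : (σ →₀ ℕ) × (σ →₀ ℕ)}
    (hx : x ∈ antidiagonal χ) (h0 : x.1 ≠ 0) : x.2.degree < χ.degree := by
  rw [mem_antidiagonal] at hx
  have h3 : x.1.degree ≠ 0 := fun h => h0 ((Finsupp.degree_eq_zero_iff _).1 h)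
  rw [← hx, map_add]
  omega

/-- Since c(0) = 0, the right side of the recursion involves only smaller multisets, and |χ| is
invertible for χ ≠ 0. This is how identities between families are proved: it suffices to compare
their coefficients c. -/
theorem IsExpFamily.unique {c P Q : (σ →₀ ℕ) → S} (hc : c 0 = 0) (hP : IsExpFamily c P)
    (hQ : IsExpFamily c Q) (χ : σ →₀ ℕ) : P χ = Q χ := by
  induction hd : χ.degree using Nat.strong_induction_on generalizing χ with
  | _ d ih =>
    subst hd
    by_cases h0 : χ = 0
    · rw [h0, hP.zero, hQ.zero]
    · have hd : (χ.degree : ℂ) ≠ 0 :=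
        Nat.cast_ne_zero.2 fun h => h0 ((Finsupp.degree_eq_zero_iff _).1 h)
      apply smul_right_injective S hd
      change (χ.degree : ℂ) • P χ = (χ.degree : ℂ) • Q χ
      rw [hP.degree_smul, hQ.degree_smul]
      congr 1
      refine Finset.sum_congr rfl fun x hx => ?_
      by_cases hx0 : x.1 = 0
      · rw [hx0, hc, zero_mul, zero_mul]
      · rw [ih _ (degree_lt_of_mem_antidiagonal hx hx0) _ rfl]

/-- The solution of the exponential recursion. -/
def expFamily (c : (σ →₀ ℕ) → S) (χ : σ →₀ ℕ) : S :=
  if χ = 0 then 1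
  else (-(χ.degree : ℂ)⁻¹) • ∑ x ∈ (antidiagonal χ).attach,
    if _h : x.1.1 = 0 then 0 else c x.1.1 * expFamily c x.1.2
termination_by χ.degree
decreasing_by exact degree_lt_of_mem_antidiagonal x.2 _h

theorem isExpFamily_expFamily {c : (σ →₀ ℕ) → S} (hc : c 0 = 0) :
    IsExpFamily c (expFamily c) where
  zero := by rw [expFamily, if_pos rfl]
  degree_smul χ := by
    by_cases h0 : χ = 0
    · subst h0; simp [hc]
    · have hd : (χ.degree : ℂ) ≠ 0 :=
        Nat.cast_ne_zero.2 fun h => h0 ((Finsupp.degree_eq_zero_iff _).1 h)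
      rw [expFamily, if_neg h0, smul_smul, mul_neg, mul_inv_cancel₀ hd, neg_smul, one_smul]
      congr 1
      rw [← Finset.sum_attach (antidiagonal χ)]
      refine Finset.sum_congr rfl fun x _ => ?_
      split_ifs with h
      · rw [h, hc, zero_mul]
      · rfl

theorem IsExpFamily.map {T : Type*} [Ring T] [Algebra ℂ T] {c P : (σ →₀ ℕ) → S}
    (hP : IsExpFamily c P) (f : S →ₐ[ℂ] T) :
    IsExpFamily (fun ψ => f (c ψ)) (fun χ => f (P χ)) where
  zero := by rw [hP.zero, map_one]
  degree_smul χ := by rw [← map_smul, hP.degree_smul]; simp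

end Recursion

/-! ### Adding a one-letter contribution to an exponential family -/

section Shift

variable {σ S : Type*} [CommRing S]

/-- The product `∏ y(b) ^ ψ(b)`, weighted by the multinomial coefficient, and `0` for `ψ = 0`. -/
def powerCoeff (y : σ → S) (ψ : σ →₀ ℕ) : S :=
  if ψ = 0 then 0 else (ψ.multinomial : S) * ψ.prod fun b k => y b ^ k

theorem powerCoeff_single (y : σ → S) (b : σ) : powerCoeff y (Finsupp.single b 1) = y b := by
  simp [powerCoeff, Finsupp.multinomial_eq]

/-- The operator multiplying the coefficient at `χ` by `|χ|`. -/
def eulerOp (P : MvPowerSeries σ S) : MvPowerSeries σ S :=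
  fun χ => (χ.degree : S) * MvPowerSeries.coeff χ P

theorem coeff_eulerOp (P : MvPowerSeries σ S) (χ : σ →₀ ℕ) :
    MvPowerSeries.coeff χ (eulerOp P) = (χ.degree : S) * MvPowerSeries.coeff χ P := rfl

theorem eulerOp_mul (P Q : MvPowerSeries σ S) :
    eulerOp (P * Q) = eulerOp P * Q + P * eulerOp Q := by
  ext χ
  simp only [coeff_eulerOp, map_add, MvPowerSeries.coeff_mul, Finset.mul_sum,
    ← Finset.sum_add_distrib]
  refine Finset.sum_congr rfl fun x hx => ?_
  rw [← mem_antidiagonal.1 hx, map_add]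
  push_cast
  ring

/-- The linear form `∑ y(b) t_b`. -/
def linearSeries (y : σ → S) : MvPowerSeries σ S :=
  fun χ => if χ.degree = 1 then powerCoeff y χ else 0

theorem coeff_linearSeries (y : σ → S) (χ : σ →₀ ℕ) :
    MvPowerSeries.coeff χ (linearSeries y) = if χ.degree = 1 then powerCoeff y χ else 0 := rfl

theorem eulerOp_linearSeries (y : σ → S) : eulerOp (linearSeries y) = linearSeries y := by
  ext χ
  rw [coeff_eulerOp, coeff_linearSeries]
  split_ifs with h
  · rw [h, Nat.cast_one, one_mul]
  · rw [mul_zero]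

theorem coeff_linearSeries_mul (y : σ → S) (P : MvPowerSeries σ S) (χ : σ →₀ ℕ) :
    MvPowerSeries.coeff χ (linearSeries y * P) =
      ∑ b ∈ χ.support, y b * MvPowerSeries.coeff (χ - Finsupp.single b 1) P := by
  simp only [MvPowerSeries.coeff_mul, coeff_linearSeries, ite_mul, zero_mul]
  rw [sum_antidiagonal_degree_eq_one χ fun a c => powerCoeff y a * MvPowerSeries.coeff c P]
  simp only [powerCoeff_single]

/-- The series `u + u ^ 2 + ⋯` for `u = ∑ y(b) t_b`. -/
def powerSumSeries (y : σ → S) : MvPowerSeries σ S := powerCoeff y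

/-- The geometric series identity F = u + uF; coefficientwise it is Pascal's rule for multinomials.
-/
theorem powerSumSeries_eq (y : σ → S) :
    powerSumSeries y = linearSeries y + linearSeries y * powerSumSeries y := by
  ext χ
  rw [map_add, coeff_linearSeries_mul, coeff_linearSeries]
  change powerCoeff y χ = _ + ∑ b ∈ χ.support, y b * powerCoeff y (χ - Finsupp.single b 1)
  by_cases h0 : χ = 0
  · subst h0; simp [powerCoeff]
  by_cases h1 : χ.degree = 1
  · rw [if_pos h1, left_eq_add]
    obtain ⟨b, rfl⟩ := exists_single_of_degree_eq_one h1
    simp [powerCoeff]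
  · rw [if_neg h1, zero_add, powerCoeff, if_neg h0, multinomial_eq_sum_sub_single h0,
      Nat.cast_sum, Finset.sum_mul]
    refine Finset.sum_congr rfl fun b hb => ?_
    have h2 : χ - Finsupp.single b 1 ≠ 0 := by
      intro h
      have := degree_sub_single_add_one hb
      rw [h] at this
      simp at this
      omega
    rw [powerCoeff, if_neg h2]
    conv_lhs => rw [← sub_single_add_single hb]
    rw [Finsupp.prod_add_index' (by simp) (by simp [pow_add]), Finsupp.prod_single_index (by simp),
      add_tsub_cancel_right, pow_one]
    ring

/-- Adding F = u/(1 - u) to c multiplies the generating series by 1 - u, because E(1 - u) = -u =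
-F(1 - u) and E is a derivation. -/
theorem IsExpFamily.shift [Algebra ℂ S] {c P : (σ →₀ ℕ) → S} (hP : IsExpFamily c P) (y : σ → S) :
    IsExpFamily (fun ψ => c ψ + powerCoeff y ψ)
      (fun χ => P χ - ∑ b ∈ χ.support, y b * P (χ - Finsupp.single b 1)) where
  zero := by simp [hP.zero]
  degree_smul χ := by
    let P' : MvPowerSeries σ S := P
    let c' : MvPowerSeries σ S := c
    let F := powerSumSeries y
    let u := linearSeries y
    have hE : eulerOp P' = -(c' * P') := by
      ext χ
      rw [coeff_eulerOp, map_neg, MvPowerSeries.coeff_mul]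
      have := hP.degree_smul χ
      rw [Algebra.smul_def, map_natCast] at this
      exact this
    have hF : F = u + u * F := powerSumSeries_eq y
    have hu : eulerOp u = u := eulerOp_linearSeries y
    have key : eulerOp (P' - u * P') = -((c' + F) * (P' - u * P')) := by
      have h1 : eulerOp (P' - u * P') = eulerOp P' - eulerOp (u * P') := by
        ext χ
        simp only [coeff_eulerOp, map_sub, mul_sub]
      rw [h1, eulerOp_mul, hE, hu]
      linear_combination P' * hF
    have h2 : ∀ χ, MvPowerSeries.coeff χ (P' - u * P') =
        P χ - ∑ b ∈ χ.support, y b * P (χ - Finsupp.single b 1) := by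
      intro χ
      rw [map_sub, coeff_linearSeries_mul]
      rfl
    have h3 := congrArg (MvPowerSeries.coeff χ) key
    rw [coeff_eulerOp, map_neg, MvPowerSeries.coeff_mul] at h3
    simp only [h2] at h3
    rw [Algebra.smul_def, map_natCast]
    exact h3

end Shift

/-! ### Leading terms of polynomials -/

section Leading

variable {τ : Type*}

/-- The polynomials of degree less than `d`. -/
def lowDegree (τ : Type*) (d : ℕ) : Submodule ℂ (MvPolynomial τ ℂ) :=
  MvPolynomial.restrictSupport ℂ {s | s.degree < d}

theorem mem_lowDegree {d : ℕ} {f : MvPolynomial τ ℂ} :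
    f ∈ lowDegree τ d ↔ ∀ s, d ≤ s.degree → f.coeff s = 0 := by
  rw [lowDegree, MvPolynomial.mem_restrictSupport_iff]
  constructor
  · intro h s hs
    by_contra hc
    exact absurd (h (MvPolynomial.mem_support_iff.2 hc)) (by simpa using hs)
  · intro h s hs
    by_contra hc
    exact MvPolynomial.mem_support_iff.1 hs (h s (by simpa using hc))

theorem lowDegree_mono {d e : ℕ} (h : d ≤ e) : lowDegree τ d ≤ lowDegree τ e :=
  fun _ hf => mem_lowDegree.2 fun s hs => mem_lowDegree.1 hf s (h.trans hs)

/-- Asymmetric bounds: degree less than d times degree at most e gives degree less than d + e, which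
is the form needed for error terms. -/
theorem mul_mem_lowDegree {d e : ℕ} {f g : MvPolynomial τ ℂ} (hf : f ∈ lowDegree τ d)
    (hg : g ∈ lowDegree τ (e + 1)) : f * g ∈ lowDegree τ (d + e) := by
  rw [mem_lowDegree] at *
  intro s hs
  rw [MvPolynomial.coeff_mul]
  refine Finset.sum_eq_zero fun x hx => ?_
  have h := congrArg Finsupp.degree (mem_antidiagonal.1 hx)
  rw [map_add] at h
  by_cases h1 : d ≤ x.1.degree
  · rw [hf _ h1, zero_mul]
  · rw [hg _ (by omega), mul_zero]

theorem monomial_mem_lowDegree {s : τ →₀ ℕ} {d : ℕ} (h : s.degree < d) (a : ℂ) :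
    MvPolynomial.monomial s a ∈ lowDegree τ d := by
  rw [mem_lowDegree]
  intro t ht
  rw [MvPolynomial.coeff_monomial, if_neg]
  rintro rfl
  omega

theorem X_mem_lowDegree (t : τ) : (MvPolynomial.X t : MvPolynomial τ ℂ) ∈ lowDegree τ 2 :=
  monomial_mem_lowDegree (by simp) 1

/-- The polynomials `f` and `g` have degree at most `d` and agree in degree `d`. -/
structure SameLeading (d : ℕ) (f g : MvPolynomial τ ℂ) : Prop where
  sub_mem : f - g ∈ lowDegree τ d
  right_mem : g ∈ lowDegree τ (d + 1)

namespace SameLeading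

theorem refl {d : ℕ} {f : MvPolynomial τ ℂ} (h : f ∈ lowDegree τ (d + 1)) : SameLeading d f f :=
  ⟨by rw [sub_self]; exact zero_mem _, h⟩

theorem left_mem {d : ℕ} {f g : MvPolynomial τ ℂ} (h : SameLeading d f g) :
    f ∈ lowDegree τ (d + 1) := by
  rw [← sub_add_cancel f g]
  exact add_mem (lowDegree_mono d.le_succ h.sub_mem) h.right_mem

theorem mul {d e : ℕ} {f g f' g' : MvPolynomial τ ℂ} (h : SameLeading d f g)
    (h' : SameLeading e f' g') : SameLeading (d + e) (f * f') (g * g') where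
  sub_mem := by
    have : f * f' - g * g' = (f - g) * f' + (f' - g') * g := by ring
    rw [this]
    refine add_mem (mul_mem_lowDegree h.sub_mem h'.left_mem) ?_
    rw [add_comm d e]
    exact mul_mem_lowDegree h'.sub_mem h.right_mem
  right_mem := by
    rw [add_right_comm]
    exact mul_mem_lowDegree h.right_mem h'.right_mem

theorem one : SameLeading 0 (1 : MvPolynomial τ ℂ) 1 :=
  refl (monomial_mem_lowDegree (by simp) 1)

theorem prod {ι : Type*} (s : Finset ι) {d : ι → ℕ} {f g : ι → MvPolynomial τ ℂ}
    (h : ∀ i ∈ s, SameLeading (d i) (f i) (g i)) :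
    SameLeading (∑ i ∈ s, d i) (∏ i ∈ s, f i) (∏ i ∈ s, g i) := by
  induction s using Finset.induction_on with
  | empty => simpa using one
  | insert a s ha ih =>
    rw [Finset.sum_insert ha, Finset.prod_insert ha, Finset.prod_insert ha]
    exact (h a (Finset.mem_insert_self a s)).mul
      (ih fun i hi => h i (Finset.mem_insert_of_mem hi))

theorem rename {τ' : Type*} (e : τ → τ') {d : ℕ} {f g : MvPolynomial τ ℂ}
    (h : SameLeading d f g) :
    SameLeading d (MvPolynomial.rename e f) (MvPolynomial.rename e g) := by
  have key : ∀ {n : ℕ} {f : MvPolynomial τ ℂ}, f ∈ lowDegree τ n →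
      MvPolynomial.rename e f ∈ lowDegree τ' n := by
    intro n f hf
    rw [mem_lowDegree] at *
    intro s hs
    by_contra hc
    obtain ⟨u, rfl, hu⟩ := MvPolynomial.coeff_rename_ne_zero e f s hc
    rw [Finsupp.degree_mapDomain] at hs
    exact hu (hf u hs)
  exact ⟨by rw [← map_sub]; exact key h.sub_mem, key h.right_mem⟩

end SameLeading

/-- In a relation choose k with `e k` of maximal degree; the coefficient at the monomial `e k` then
comes from `v k` alone. -/
theorem linearIndependent_of_sameLeading {κ : Type*} {v : κ → MvPolynomial τ ℂ}
    {e : κ → (τ →₀ ℕ)} (he : Function.Injective e) {a : κ → ℂ} (ha : ∀ k, a k ≠ 0)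
    (hv : ∀ k, SameLeading (e k).degree (v k) (MvPolynomial.monomial (e k) (a k))) :
    LinearIndependent ℂ v := by
  rw [linearIndependent_iff]
  intro l hl
  by_contra h0
  obtain ⟨k, hk, hmax⟩ := Finset.exists_max_image l.support (fun k => (e k).degree)
    (Finsupp.support_nonempty_iff.2 h0)
  have h1 := congrArg (MvPolynomial.coeff (e k)) hl
  rw [Finsupp.linearCombination_apply, Finsupp.sum, MvPolynomial.coeff_sum,
    Finset.sum_eq_single_of_mem k hk] at h1
  · have h2 := mem_lowDegree.1 (hv k).sub_mem _ le_rfl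
    rw [MvPolynomial.coeff_sub, MvPolynomial.coeff_monomial, if_pos rfl, sub_eq_zero] at h2
    rw [MvPolynomial.coeff_smul, h2, MvPolynomial.coeff_zero, smul_eq_mul] at h1
    exact mul_ne_zero (Finsupp.mem_support_iff.1 hk) (ha k) h1
  · intro j hj hjk
    have h2 := mem_lowDegree.1 (hv j).sub_mem _ (hmax j hj)
    rw [MvPolynomial.coeff_sub, MvPolynomial.coeff_monomial, if_neg (fun h => hjk (he h)),
      sub_zero] at h2
    rw [MvPolynomial.coeff_smul, h2, smul_zero]

theorem span_eq_top_of_sameLeading {v : (τ →₀ ℕ) → MvPolynomial τ ℂ} {a : (τ →₀ ℕ) → ℂ}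
    (ha : ∀ s, a s ≠ 0) (hv : ∀ s, SameLeading s.degree (v s) (MvPolynomial.monomial s (a s))) :
    Submodule.span ℂ (Set.range v) = ⊤ := by
  have key : ∀ d, ∀ f ∈ lowDegree τ d, f ∈ Submodule.span ℂ (Set.range v) := by
    intro d
    induction d using Nat.strong_induction_on with
    | _ d ih =>
      intro f hf
      rw [f.as_sum]
      refine sum_mem fun s hs => ?_
      have hsd : s.degree < d := by
        by_contra hc
        exact MvPolynomial.mem_support_iff.1 hs (mem_lowDegree.1 hf s (not_lt.1 hc))
      have h1 : MvPolynomial.monomial s (a s) ∈ Submodule.span ℂ (Set.range v) := by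
        rw [← sub_sub_cancel (v s) (MvPolynomial.monomial s (a s))]
        exact sub_mem (Submodule.subset_span ⟨s, rfl⟩) (ih _ hsd _ (hv s).sub_mem)
      have h2 := Submodule.smul_mem _ (f.coeff s / a s) h1
      rwa [MvPolynomial.smul_monomial, smul_eq_mul, div_mul_cancel₀ _ (ha s)] at h2
  rw [eq_top_iff]
  intro f _
  refine key (f.totalDegree + 1) f (mem_lowDegree.2 fun s hs => ?_)
  by_contra hc
  have := MvPolynomial.le_totalDegree (MvPolynomial.mem_support_iff.2 hc)
  rw [Finsupp.degree_apply] at hs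
  simp only [Finsupp.sum] at this
  omega

/-- The coefficient of the leading monomial of an exponential family of polynomials. -/
def leadCoeff (χ : τ →₀ ℕ) : ℂ :=
  (-1) ^ χ.degree / (χ.prod (fun _ k => k.factorial) : ℕ)

theorem leadCoeff_ne_zero (χ : τ →₀ ℕ) : leadCoeff χ ≠ 0 :=
  div_ne_zero (pow_ne_zero _ (by norm_num)) (Nat.cast_ne_zero.2 (prod_factorial_pos χ).ne')

theorem leadCoeff_sub_single {χ : τ →₀ ℕ} {b : τ} (hb : b ∈ χ.support) :
    leadCoeff (χ - Finsupp.single b 1) = -(χ b * leadCoeff χ) := by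
  have h1 := Nat.cast_ne_zero (R := ℂ).2 (prod_factorial_pos (χ - Finsupp.single b 1)).ne'
  have h2 : (χ b : ℂ) ≠ 0 := by exact_mod_cast Finsupp.mem_support_iff.1 hb
  rw [leadCoeff, leadCoeff, ← prod_factorial_sub_single hb, ← degree_sub_single_add_one hb]
  push_cast
  field_simp
  ring

/-- Every c(ψ) has degree at most 1, so a term of the recursion with |ψ| ≥ 2 loses degree. Only
single letters contribute to the top degree, where the family looks like exp(-∑ X_b t_b). -/
theorem IsExpFamily.sameLeading {c P : (τ →₀ ℕ) → MvPolynomial τ ℂ} (hP : IsExpFamily c P)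
    (hc0 : c 0 = 0) (hc1 : ∀ b, c (Finsupp.single b 1) = MvPolynomial.X b)
    (hc : ∀ ψ, c ψ ∈ lowDegree τ 2) (χ : τ →₀ ℕ) :
    SameLeading χ.degree (P χ) (MvPolynomial.monomial χ (leadCoeff χ)) := by
  induction hd : χ.degree using Nat.strong_induction_on generalizing χ with
  | _ d ih =>
    subst hd
    refine ⟨?_, monomial_mem_lowDegree (Nat.lt_succ_self _) _⟩
    by_cases h0 : χ = 0
    · subst h0
      have : MvPolynomial.monomial (0 : τ →₀ ℕ) (leadCoeff (0 : τ →₀ ℕ)) = 1 := by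
        simp [leadCoeff]
      rw [hP.zero, this, sub_self]
      exact zero_mem _
    have hd : (χ.degree : ℂ) ≠ 0 :=
      Nat.cast_ne_zero.2 fun h => h0 ((Finsupp.degree_eq_zero_iff _).1 h)
    rw [← Submodule.smul_mem_iff _ hd, smul_sub, hP.degree_smul]
    have hsplit : ∑ x ∈ antidiagonal χ, c x.1 * P x.2 =
        ∑ x ∈ antidiagonal χ, (if x.1.degree = 1 then c x.1 * P x.2 else 0) +
        ∑ x ∈ antidiagonal χ, (if x.1.degree = 1 then 0 else c x.1 * P x.2) := by
      rw [← Finset.sum_add_distrib]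
      refine Finset.sum_congr rfl fun x _ => ?_
      split_ifs <;> simp
    -- The leading monomials satisfy the recursion truncated to single letters, because the
    -- multiplicities χ(b) add up to |χ|.
    have hmain : (χ.degree : ℂ) • MvPolynomial.monomial χ (leadCoeff χ) =
        -∑ b ∈ χ.support, MvPolynomial.X b *
          MvPolynomial.monomial (χ - Finsupp.single b 1) (leadCoeff (χ - Finsupp.single b 1)) := by
      have h1 : ∀ b ∈ χ.support, (MvPolynomial.X b * MvPolynomial.monomial
          (χ - Finsupp.single b 1) (leadCoeff (χ - Finsupp.single b 1)) : MvPolynomial τ ℂ) =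
          MvPolynomial.monomial χ (-(χ b * leadCoeff χ)) := by
        intro b hb
        rw [MvPolynomial.X, MvPolynomial.monomial_mul, add_comm, sub_single_add_single hb,
          leadCoeff_sub_single hb, one_mul]
      rw [Finset.sum_congr rfl h1, ← map_sum, ← map_neg, MvPolynomial.smul_monomial,
        Finset.sum_neg_distrib, neg_neg, ← Finset.sum_mul, Finsupp.degree_apply, smul_eq_mul]
      push_cast
      rfl
    rw [hsplit, sum_antidiagonal_degree_eq_one χ fun ψ ρ => c ψ * P ρ, hmain]
    have hre : ∀ a b m : MvPolynomial τ ℂ, -(a + b) - -m = -(a - m) - b := by intros; ring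
    rw [hre, ← Finset.sum_sub_distrib]
    refine sub_mem (neg_mem (sum_mem fun b hb => ?_)) (sum_mem fun x hx => ?_)
    · have hlt := degree_sub_single_add_one hb
      have h1 := (ih _ (by omega) (χ - Finsupp.single b 1) rfl).sub_mem
      rw [hc1, ← mul_sub, mul_comm, ← hlt]
      exact mul_mem_lowDegree h1 (X_mem_lowDegree b)
    · split_ifs with h1
      · exact zero_mem _
      by_cases hx0 : x.1 = 0
      · rw [hx0, hc0, zero_mul]; exact zero_mem _
      · have hlt := degree_lt_of_mem_antidiagonal hx hx0
        have h2 := (ih _ hlt x.2 rfl).left_mem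
        have h3 : x.1.degree ≠ 0 := fun h => hx0 ((Finsupp.degree_eq_zero_iff _).1 h)
        have h4 := congrArg Finsupp.degree (mem_antidiagonal.1 hx)
        rw [map_add] at h4
        exact lowDegree_mono (by omega) (mul_mem_lowDegree (hc x.1) h2)

end Leading

/-! ### The universal commutative family attached to a semigroup of letters -/

section Letters

variable {σ : Type*} [CommSemigroup σ]

/-- The product of a finite multiset of letters; it is a letter unless the multiset is empty. -/
def letterProd (ψ : σ →₀ ℕ) : WithOne σ := ψ.prod fun b k => (b : WithOne σ) ^ k

theorem letterProd_single (b : σ) : letterProd (Finsupp.single b 1) = b := by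
  simp [letterProd]

/-- Ensures that the recursion only meets genuine variables: the default value 0 of `letterVar` at
the adjoined unit never contributes. -/
theorem letterProd_ne_one {ψ : σ →₀ ℕ} (h : ψ ≠ 0) : letterProd ψ ≠ 1 := by
  obtain ⟨b, hb⟩ := Finsupp.support_nonempty_iff.2 h
  rw [← sub_single_add_single hb, letterProd,
    Finsupp.prod_add_index' (by simp) (by simp [pow_add]), Finsupp.prod_single_index (by simp),
    pow_one]
  generalize ((ψ - Finsupp.single b 1).prod fun b k => (b : WithOne σ) ^ k) = x
  induction x using WithOne.recOneCoe with
  | one => rw [one_mul]; exact WithOne.coe_ne_one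
  | coe a => rw [← WithOne.coe_mul]; exact WithOne.coe_ne_one

/-- The coefficients `m(ψ) X(π(ψ))` of the recursion defined by a family `X`. -/
def letterCoeff {S : Type*} [Ring S] (X : WithOne σ → S) (ψ : σ →₀ ℕ) : S :=
  if ψ = 0 then 0 else (ψ.multinomial : S) * X (letterProd ψ)

theorem letterCoeff_zero {S : Type*} [Ring S] (X : WithOne σ → S) : letterCoeff X 0 = 0 :=
  if_pos rfl

/-- The variable attached to a letter. -/
def letterVar {σ : Type*} (m : WithOne σ) : MvPolynomial σ ℂ := WithOne.recOneCoe 0 MvPolynomial.X m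

@[simp]
theorem letterVar_coe {σ : Type*} (b : σ) : letterVar (b : WithOne σ) = MvPolynomial.X b := rfl

theorem letterVar_mem_lowDegree {σ : Type*} (m : WithOne σ) : letterVar m ∈ lowDegree σ 2 := by
  induction m using WithOne.recOneCoe with
  | one => exact zero_mem _
  | coe b => exact X_mem_lowDegree b

/-- The universal commutative version of the elements `p(χ)`. -/
def univP : (σ →₀ ℕ) → MvPolynomial σ ℂ := expFamily (letterCoeff letterVar)

theorem isExpFamily_univP : IsExpFamily (letterCoeff (σ := σ) letterVar) univP :=
  isExpFamily_expFamily (letterCoeff_zero _)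

theorem sameLeading_univP (χ : σ →₀ ℕ) :
    SameLeading χ.degree (univP χ) (MvPolynomial.monomial χ (leadCoeff χ)) := by
  refine isExpFamily_univP.sameLeading (letterCoeff_zero _) (fun b => ?_) (fun ψ => ?_) χ
  · rw [letterCoeff, if_neg (by simp), letterProd_single, letterVar_coe]
    simp [Finsupp.multinomial_eq]
  · rw [letterCoeff]
    split_ifs
    · exact zero_mem _
    · rw [← nsmul_eq_mul]
      exact nsmul_mem (letterVar_mem_lowDegree _) _

/-- The basis of the polynomial ring formed by the elements `univP χ`. -/
def univBasis : Module.Basis (σ →₀ ℕ) ℂ (MvPolynomial σ ℂ) :=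
  Module.Basis.mk
    (linearIndependent_of_sameLeading Function.injective_id leadCoeff_ne_zero sameLeading_univP)
    (span_eq_top_of_sameLeading leadCoeff_ne_zero sameLeading_univP).ge

theorem univBasis_apply (χ : σ →₀ ℕ) : univBasis χ = univP χ := by
  rw [univBasis, Module.Basis.mk_apply]

/-- The homomorphism `X_b ↦ X_b + e_b`. -/
def letterShift : MvPolynomial σ ℂ →ₐ[ℂ] MonoidAlgebra (MvPolynomial σ ℂ) (WithOne σ) :=
  MvPolynomial.aeval fun b =>
    MonoidAlgebra.single 1 (MvPolynomial.X b) + MonoidAlgebra.single (b : WithOne σ) 1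

/-- Both sides solve the same exponential recursion: the left as the image of `univP`, the right by
`IsExpFamily.shift` with y(b) = e_b. -/
theorem letterShift_univP (χ : σ →₀ ℕ) :
    letterShift (univP χ) = MonoidAlgebra.single 1 (univP χ) -
      ∑ b ∈ χ.support, MonoidAlgebra.single (b : WithOne σ) (univP (χ - Finsupp.single b 1)) := by
  have h1 := (isExpFamily_univP (σ := σ)).map letterShift
  have h2 := ((isExpFamily_univP (σ := σ)).map
    (MonoidAlgebra.singleOneAlgHom (A := MvPolynomial σ ℂ) (M := WithOne σ))).shift
      fun b : σ => MonoidAlgebra.single (b : WithOne σ) 1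
  -- The shift sends X at the letter π(ψ) to itself plus e at π(ψ), and the latter is ∏ e_b^ψ(b) by
  -- multiplicativity.
  have hc : (fun ψ : σ →₀ ℕ => letterShift (letterCoeff letterVar ψ)) = fun ψ =>
      MonoidAlgebra.singleOneAlgHom (R := ℂ) (A := MvPolynomial σ ℂ) (M := WithOne σ)
        (letterCoeff letterVar ψ) +
      powerCoeff (fun b : σ => MonoidAlgebra.single (b : WithOne σ) (1 : MvPolynomial σ ℂ)) ψ := by
    funext ψ
    rw [letterCoeff, powerCoeff]
    split_ifs with h0
    · simp
    · have hp : ψ.prod (fun b k => MonoidAlgebra.single (b : WithOne σ)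
          (1 : MvPolynomial σ ℂ) ^ k) = MonoidAlgebra.single (letterProd ψ) 1 := by
        change _ = MonoidAlgebra.of (MvPolynomial σ ℂ) (WithOne σ) (letterProd ψ)
        rw [letterProd, map_finsuppProd]
        simp only [map_pow]
        rfl
      obtain ⟨b, hb⟩ := WithOne.ne_one_iff_exists.1 (letterProd_ne_one h0)
      rw [hp, ← hb, letterVar_coe, map_mul, map_mul, map_natCast, map_natCast, ← mul_add,
        letterShift, MvPolynomial.aeval_X]
      rfl
  rw [hc] at h1
  have h3 := h1.unique (by simp [letterCoeff_zero, powerCoeff]) h2 χ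
  rw [h3]
  congr 1
  refine Finset.sum_congr rfl fun b _ => ?_
  change MonoidAlgebra.single (b : WithOne σ) 1 * MonoidAlgebra.single 1 _ = _
  rw [MonoidAlgebra.single_mul_single, mul_one, one_mul]

/-- The coefficient of `e_b` in the shift. -/
def letterDeriv (b : σ) : MvPolynomial σ ℂ →ₗ[ℂ] MvPolynomial σ ℂ where
  toFun f := (letterShift f).coeff b
  map_add' f g := by rw [map_add]; rfl
  map_smul' c f := by rw [map_smul]; rfl

/-- The unit of the monoid algebra is the freshly adjoined one, so the unshifted term never
contributes to e_b, even if b is an identity of `σ`. -/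
theorem letterDeriv_univP (b : σ) (χ : σ →₀ ℕ) :
    letterDeriv b (univP χ) =
      if b ∈ χ.support then -univP (χ - Finsupp.single b 1) else 0 := by
  change (letterShift (univP χ)).coeff b = _
  rw [letterShift_univP, MonoidAlgebra.coeff_sub, MonoidAlgebra.coeff_sum]
  simp only [MonoidAlgebra.coeff_single, Finsupp.sub_apply, Finsupp.finsetSum_apply,
    Finsupp.single_apply, WithOne.one_ne_coe, WithOne.coe_inj, if_false, zero_sub,
    Finset.sum_ite_eq']
  split_ifs <;> simp

theorem univBasis_repr_letterDeriv (b : σ) (f : MvPolynomial σ ℂ) (ρ : σ →₀ ℕ) :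
    univBasis.repr (letterDeriv b f) ρ = -univBasis.repr f (ρ + Finsupp.single b 1) := by
  have h : (Finsupp.lapply ρ).comp (univBasis.repr.toLinearMap.comp (letterDeriv b)) =
      -(Finsupp.lapply (ρ + Finsupp.single b 1)).comp univBasis.repr.toLinearMap := by
    refine univBasis.ext fun χ => ?_
    simp only [LinearMap.comp_apply, LinearMap.neg_apply, LinearEquiv.coe_coe,
      Module.Basis.repr_self, Finsupp.lapply_apply]
    rw [univBasis_apply, letterDeriv_univP]
    split_ifs with hb
    · rw [map_neg, ← univBasis_apply, Module.Basis.repr_self, Finsupp.neg_apply,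
        Finsupp.single_apply, Finsupp.single_apply]
      congr 1
      refine if_congr ⟨fun h => ?_, fun h => ?_⟩ rfl rfl
      · rw [← h, sub_single_add_single hb]
      · rw [h, add_tsub_cancel_right]
    · rw [map_zero, Finsupp.zero_apply, Finsupp.single_apply, if_neg, neg_zero]
      rintro rfl
      simp at hb
  exact LinearMap.congr_fun h f

theorem aeval_zero_univP (χ : σ →₀ ℕ) :
    MvPolynomial.aeval (R := ℂ) (fun _ : σ => (0 : ℂ)) (univP χ) = if χ = 0 then 1 else 0 := by
  have h1 := (isExpFamily_univP (σ := σ)).map (MvPolynomial.aeval (R := ℂ) fun _ : σ => (0 : ℂ))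
  split_ifs with h0
  · subst h0; exact h1.zero
  have hd : (χ.degree : ℂ) ≠ 0 :=
    Nat.cast_ne_zero.2 fun h => h0 ((Finsupp.degree_eq_zero_iff _).1 h)
  refine (smul_eq_zero_iff_right hd).1 ?_
  rw [h1.degree_smul, neg_eq_zero]
  refine Finset.sum_eq_zero fun x _ => ?_
  rw [letterCoeff]
  split_ifs with h2
  · rw [map_zero, zero_mul]
  · obtain ⟨b, hb⟩ := WithOne.ne_one_iff_exists.1 (letterProd_ne_one h2)
    rw [← hb, letterVar_coe, map_mul, MvPolynomial.aeval_X, mul_zero, zero_mul]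

theorem univBasis_repr_zero (f : MvPolynomial σ ℂ) :
    univBasis.repr f 0 = MvPolynomial.aeval (R := ℂ) (fun _ : σ => (0 : ℂ)) f := by
  have h : (Finsupp.lapply 0).comp univBasis.repr.toLinearMap =
      (MvPolynomial.aeval (R := ℂ) (fun _ : σ => (0 : ℂ))).toLinearMap := by
    refine univBasis.ext fun χ => ?_
    simp only [LinearMap.comp_apply, LinearEquiv.coe_coe, Module.Basis.repr_self,
      Finsupp.lapply_apply, AlgHom.toLinearMap_apply]
    rw [univBasis_apply, aeval_zero_univP, Finsupp.single_apply]
  exact LinearMap.congr_fun h f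

/-- The `ℤ`-span of the elements `univP χ`. -/
def univLattice (σ : Type*) [CommSemigroup σ] : Submodule ℤ (MvPolynomial σ ℂ) :=
  Submodule.span ℤ (Set.range univP)

theorem mem_univLattice_iff {f : MvPolynomial σ ℂ} :
    f ∈ univLattice σ ↔ ∀ χ, ∃ n : ℤ, (n : ℂ) = univBasis.repr f χ := by
  have hr : univLattice σ = Submodule.span ℤ (Set.range univBasis) :=
    congrArg (fun v => Submodule.span ℤ (Set.range v)) (funext fun χ => (univBasis_apply χ).symm)
  rw [hr, Module.Basis.mem_span_iff_repr_mem]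
  rfl

/-- Integrality test: the coordinate at 0 is the constant term, and the coordinate at χ ∋ b is, up
to sign, a coordinate of `letterDeriv b f`. -/
theorem mem_univLattice_of_letterDeriv {f : MvPolynomial σ ℂ}
    (h0 : ∃ n : ℤ, (n : ℂ) = MvPolynomial.aeval (R := ℂ) (fun _ : σ => (0 : ℂ)) f)
    (h : ∀ b, letterDeriv b f ∈ univLattice σ) : f ∈ univLattice σ := by
  rw [mem_univLattice_iff]
  intro χ
  by_cases hχ : χ = 0
  · obtain ⟨n, hn⟩ := h0
    exact ⟨n, by rw [hχ, univBasis_repr_zero, ← hn]⟩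
  · obtain ⟨b, hb⟩ := Finsupp.support_nonempty_iff.2 hχ
    obtain ⟨n, hn⟩ := mem_univLattice_iff.1 (h b) (χ - Finsupp.single b 1)
    rw [univBasis_repr_letterDeriv, sub_single_add_single hb] at hn
    exact ⟨-n, by rw [Int.cast_neg, hn, neg_neg]⟩

/-- Apply the integrality test. The shift is multiplicative, so the coefficient of e_b in the
shifted product is an integral combination of products of smaller total degree. -/
theorem univP_mul_univP_mem (χ ψ : σ →₀ ℕ) : univP χ * univP ψ ∈ univLattice σ := by
  induction hd : χ.degree + ψ.degree using Nat.strong_induction_on generalizing χ ψ with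
  | _ d ih =>
    subst hd
    refine mem_univLattice_of_letterDeriv ?_ fun b => ?_
    · rw [map_mul, aeval_zero_univP, aeval_zero_univP]
      split_ifs
      · exact ⟨1, by simp⟩
      all_goals exact ⟨0, by simp⟩
    · have hs : ∀ (m : WithOne σ) (r : MvPolynomial σ ℂ), r ∈ univLattice σ →
          (MonoidAlgebra.single m r).coeff b ∈ univLattice σ := by
        intro m r hr
        rw [MonoidAlgebra.coeff_single, Finsupp.single_apply]
        split_ifs
        · exact hr
        · exact zero_mem _
      have h1 : (MonoidAlgebra.single (1 : WithOne σ) (univP χ * univP ψ)).coeff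
          (b : WithOne σ) = 0 := by
        rw [MonoidAlgebra.coeff_single, Finsupp.single_apply, if_neg WithOne.one_ne_coe]
      change (letterShift (univP χ * univP ψ)).coeff b ∈ _
      rw [map_mul, letterShift_univP, letterShift_univP, sub_mul, mul_sub, mul_sub,
        MonoidAlgebra.single_mul_single, one_mul, Finset.mul_sum, Finset.sum_mul,
        Finset.sum_mul_sum]
      simp only [MonoidAlgebra.single_mul_single, MonoidAlgebra.coeff_sub, Finsupp.sub_apply,
        MonoidAlgebra.coeff_sum, Finsupp.finsetSum_apply]
      rw [h1]
      refine sub_mem (sub_mem (zero_mem _) (sum_mem fun c hc => hs _ _ (ih _ ?_ _ _ rfl)))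
        (sub_mem (sum_mem fun c hc => hs _ _ (ih _ ?_ _ _ rfl))
          (sum_mem fun c hc => sum_mem fun c' hc' => hs _ _ (ih _ ?_ _ _ rfl)))
      · have := degree_sub_single_add_one hc
        omega
      · have := degree_sub_single_add_one hc
        omega
      · have := degree_sub_single_add_one hc
        have := degree_sub_single_add_one hc'
        omega

theorem univLattice_mul_le : univLattice σ * univLattice σ ≤ univLattice σ := by
  rw [univLattice, Submodule.span_mul_span, Submodule.span_le]
  rintro _ ⟨_, ⟨χ, rfl⟩, _, ⟨ψ, rfl⟩, rfl⟩
  exact univP_mul_univP_mem χ ψ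

end Letters

/-! ### Products over several colours -/

section Colours

variable {ι σ : Type*} [Fintype ι] [CommSemigroup σ]

/-- The copy of `univP χ` in the variables of colour `i`. -/
def colourP (i : ι) (χ : σ →₀ ℕ) : MvPolynomial (ι × σ) ℂ :=
  MvPolynomial.rename (Prod.mk i) (univP χ)

/-- The product of the elements `colourP i (ψ i)`. -/
def colourProd (ψ : ι → σ →₀ ℕ) : MvPolynomial (ι × σ) ℂ := ∏ i, colourP i (ψ i)

theorem linearIndependent_colourProd :
    LinearIndependent ℂ (colourProd : (ι → σ →₀ ℕ) → MvPolynomial (ι × σ) ℂ) := by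
  -- The exponent of the leading monomial; it determines ψ because the colours use disjoint
  -- variables.
  let e : (ι → σ →₀ ℕ) → (ι × σ →₀ ℕ) := fun ψ => ∑ i, (ψ i).mapDomain (Prod.mk i)
  have he : ∀ ψ i b, e ψ (i, b) = ψ i b := by
    intro ψ i b
    simp only [e, Finsupp.finsetSum_apply]
    rw [Finset.sum_eq_single_of_mem i (Finset.mem_univ i),
      Finsupp.mapDomain_apply (Prod.mk_right_injective i)]
    intro j _ hj
    refine Finsupp.mapDomain_of_notMem_range _ _ ?_
    rintro ⟨c, hc⟩
    exact hj (Prod.ext_iff.1 hc).1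
  refine linearIndependent_of_sameLeading (e := e) (a := fun ψ => ∏ i, leadCoeff (ψ i)) ?_
    (fun ψ => Finset.prod_ne_zero_iff.2 fun i _ => leadCoeff_ne_zero _) fun ψ => ?_
  · intro ψ ψ' h
    funext i
    ext b
    rw [← he, h, he]
  · have hdeg : (e ψ).degree = ∑ i, (ψ i).degree := by
      simp only [e, map_sum, Finsupp.degree_mapDomain]
    have hmon : MvPolynomial.monomial (e ψ) (∏ i, leadCoeff (ψ i)) = ∏ i,
        MvPolynomial.rename (Prod.mk i) (MvPolynomial.monomial (ψ i) (leadCoeff (ψ i))) := by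
      simp only [MvPolynomial.rename_monomial, e]
      induction (Finset.univ : Finset ι) using Finset.induction_on with
      | empty => simp
      | insert a s ha ih =>
        rw [Finset.sum_insert ha, Finset.prod_insert ha, Finset.prod_insert ha, ← ih,
          MvPolynomial.monomial_mul]
    rw [hdeg, hmon]
    exact SameLeading.prod _ fun i _ => (sameLeading_univP (ψ i)).rename (Prod.mk i)

/-- As a product of submodules, one per colour, the span inherits closure under multiplication from
the one-colour lattice. -/
theorem span_colourProd_eq_prod :
    Submodule.span ℤ (Set.range (colourProd : (ι → σ →₀ ℕ) → MvPolynomial (ι × σ) ℂ)) =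
      ∏ i : ι, (univLattice σ).map
        ((MvPolynomial.rename (R := ℂ) (Prod.mk i)).toRingHom.toIntAlgHom.toLinearMap) := by
  simp only [univLattice, Submodule.map_span, ← Set.range_comp]
  rw [Submodule.prod_span]
  congr 1
  ext f
  rw [Set.mem_fintype_prod]
  constructor
  · rintro ⟨ψ, rfl⟩
    exact ⟨fun i => colourP i (ψ i), fun {i} => ⟨ψ i, rfl⟩, rfl⟩
  · rintro ⟨g, hg, rfl⟩
    choose ψ hψ using fun i => @hg i
    exact ⟨ψ, Finset.prod_congr rfl fun i _ => hψ i⟩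

theorem span_colourProd_mul_le :
    Submodule.span ℤ (Set.range (colourProd : (ι → σ →₀ ℕ) → MvPolynomial (ι × σ) ℂ)) *
      Submodule.span ℤ (Set.range colourProd) ≤ Submodule.span ℤ (Set.range colourProd) := by
  rw [span_colourProd_eq_prod, ← Finset.prod_mul_distrib]
  refine Finset.prod_le_prod' fun i _ => ?_
  rw [← Submodule.map_mul]
  exact Submodule.map_mono univLattice_mul_le

theorem colourProd_single (i : ι) (χ : σ →₀ ℕ) :
    colourProd (Function.update (0 : ι → σ →₀ ℕ) i χ) = colourP i χ := by
  rw [colourProd, Finset.prod_eq_single_of_mem i (Finset.mem_univ i), Function.update_self]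
  intro j _ hj
  rw [Function.update_of_ne hj, Pi.zero_apply, colourP, isExpFamily_univP.zero, map_one]

theorem adjoin_colourP_eq_span :
    (Algebra.adjoin ℤ {f : MvPolynomial (ι × σ) ℂ | ∃ i χ, f = colourP i χ}).toSubmodule =
      Submodule.span ℤ (Set.range colourProd) := by
  apply le_antisymm
  · have h1 : (1 : MvPolynomial (ι × σ) ℂ) ∈ Submodule.span ℤ (Set.range colourProd) := by
      refine Submodule.subset_span ⟨0, Finset.prod_eq_one fun i _ => ?_⟩
      rw [Pi.zero_apply, colourP, isExpFamily_univP.zero, map_one]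
    have h2 : Algebra.adjoin ℤ {f : MvPolynomial (ι × σ) ℂ | ∃ i χ, f = colourP i χ} ≤
        (Submodule.span ℤ (Set.range colourProd)).toSubalgebra h1
          fun x y hx hy => span_colourProd_mul_le (Submodule.mul_mem_mul hx hy) := by
      rw [Algebra.adjoin_le_iff]
      rintro _ ⟨i, χ, rfl⟩
      exact Submodule.subset_span ⟨_, colourProd_single i χ⟩
    exact h2
  · rw [Submodule.span_le]
    rintro _ ⟨ψ, rfl⟩
    exact Subalgebra.prod_mem _ fun i _ => Algebra.subset_adjoin ⟨i, ψ i, rfl⟩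

end Colours

/-! ### Commuting elements of an enveloping algebra -/

section Affine

variable {L τ : Type*} [LieRing L] [LieAlgebra ℂ L] (β : Module.Basis τ ℂ L)

/-- The linear form attached to an element of `L`, in variables indexed by a basis of `L`. -/
def linForm : L →ₗ[ℂ] MvPolynomial τ ℂ := β.constr ℂ MvPolynomial.X

theorem linForm_basis (t : τ) : linForm β (β t) = MvPolynomial.X t :=
  β.constr_basis ℂ _ t

theorem linForm_mem_lowDegree (v : L) : linForm β v ∈ lowDegree τ 2 := by
  rw [linForm, Module.Basis.constr_apply]
  exact sum_mem fun t _ => Submodule.smul_mem _ _ (X_mem_lowDegree t)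

/-- The derivation of the symmetric algebra of `L` extending the adjoint action of `z`. -/
def adDerivation (z : L) : Derivation ℂ (MvPolynomial τ ℂ) (MvPolynomial τ ℂ) :=
  MvPolynomial.mkDerivation ℂ fun t => linForm β ⁅z, β t⁆

theorem adDerivation_X (z : L) (t : τ) :
    adDerivation β z (MvPolynomial.X t) = linForm β ⁅z, β t⁆ :=
  MvPolynomial.mkDerivation_X ℂ _ t

theorem adDerivation_linForm (z v : L) : adDerivation β z (linForm β v) = linForm β ⁅z, v⁆ := by
  have h : (adDerivation β z).toLinearMap ∘ₗ linForm β =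
      linForm β ∘ₗ (LieAlgebra.ad ℂ L z : L →ₗ[ℂ] L) := by
    refine β.ext fun t => ?_
    change adDerivation β z (linForm β (β t)) = linForm β ⁅z, β t⁆
    rw [linForm_basis, adDerivation_X]
  exact LinearMap.congr_fun h v

theorem adDerivation_mem_lowDegree (z : L) {d : ℕ} {f : MvPolynomial τ ℂ}
    (hf : f ∈ lowDegree τ d) : adDerivation β z f ∈ lowDegree τ d := by
  rw [f.as_sum, map_sum]
  refine sum_mem fun s hs => ?_
  have hsd : s.degree < d := by
    by_contra hc
    exact MvPolynomial.mem_support_iff.1 hs (mem_lowDegree.1 hf s (not_lt.1 hc))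
  rw [adDerivation, MvPolynomial.mkDerivation_monomial]
  refine Submodule.smul_mem _ _ (sum_mem fun t ht => ?_)
  have h1 := degree_sub_single_add_one ht
  refine lowDegree_mono (by omega) (mul_mem_lowDegree (d := s.degree) (e := 1)
    (monomial_mem_lowDegree (by omega) _) (linForm_mem_lowDegree β _))

/-- The action of `L` on its symmetric algebra by `f ↦ z • f + ⁅z, w⁆ f`. -/
def affineAction (w : L) : L →ₗ⁅ℂ⁆ Module.End ℂ (MvPolynomial τ ℂ) where
  toFun z := (adDerivation β z).toLinearMap + LinearMap.mulLeft ℂ (linForm β ⁅z, w⁆)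
  map_add' y z := by
    have h : adDerivation β (y + z) = adDerivation β y + adDerivation β z :=
      MvPolynomial.derivation_ext fun t => by simp [adDerivation_X]
    refine LinearMap.ext fun f => ?_
    simp only [h, LinearMap.add_apply, LinearMap.mulLeft_apply, Derivation.coeFn_coe,
      Derivation.add_apply, add_lie, map_add]
    ring
  map_smul' c z := by
    have h : adDerivation β (c • z) = c • adDerivation β z :=
      MvPolynomial.derivation_ext fun t => by simp [adDerivation_X]
    refine LinearMap.ext fun f => ?_
    simp [h]
  map_lie' {y z} := by
    have h : adDerivation β ⁅y, z⁆ = ⁅adDerivation β y, adDerivation β z⁆ :=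
      MvPolynomial.derivation_ext fun t => by
        rw [Derivation.commutator_apply]
        simp only [adDerivation_X, adDerivation_linForm]
        rw [← map_sub, lie_lie]
    -- The cocycle identity for z ↦ ⁅z, w⁆, i.e. Jacobi; it is exactly what makes the twisted action
    -- respect brackets.
    have hw : linForm β ⁅⁅y, z⁆, w⁆ =
        adDerivation β y (linForm β ⁅z, w⁆) - adDerivation β z (linForm β ⁅y, w⁆) := by
      rw [adDerivation_linForm, adDerivation_linForm, ← map_sub, lie_lie]
    refine LinearMap.ext fun f => ?_
    rw [LieRing.of_associative_ring_bracket, h]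
    simp only [LinearMap.add_apply, LinearMap.sub_apply, Module.End.mul_apply,
      LinearMap.mulLeft_apply, Derivation.coeFn_coe,
      Derivation.commutator_apply, map_add, Derivation.leibniz, smul_eq_mul, hw]
    ring

theorem affineAction_apply (w z : L) (f : MvPolynomial τ ℂ) :
    affineAction β w z f = adDerivation β z f + linForm β ⁅z, w⁆ * f := rfl

end Affine

/-! ### Algebraic independence from the twisted adjoint action -/

section Commuting

variable {L σ : Type*} [LieRing L] [LieAlgebra ℂ L]

/-- The derivation part does not raise the degree, while multiplication by ⁅z s, w⁆, here a
variable, raises it by one. So each factor contributes its variable to the leading monomial. -/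
theorem sameLeading_affineAction {τ : Type*} (β : Module.Basis τ ℂ L) {w : L} {z : σ → L}
    {e : σ → τ} (he : ∀ s, ⁅z s, w⁆ = β (e s))
    (Φ : MvPolynomial σ ℂ →ₐ[ℂ] UniversalEnvelopingAlgebra ℂ L)
    (hΦ : ∀ s, Φ (MvPolynomial.X s) = UniversalEnvelopingAlgebra.ι ℂ (z s)) (s : σ →₀ ℕ) :
    SameLeading s.degree
      (UniversalEnvelopingAlgebra.lift ℂ (affineAction β w) (Φ (MvPolynomial.monomial s 1)) 1)
      (MvPolynomial.monomial (s.mapDomain e) 1) := by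
  induction hd : s.degree generalizing s with
  | zero =>
    rw [Finsupp.degree_eq_zero_iff] at hd
    subst hd
    have h1 : (MvPolynomial.monomial (0 : σ →₀ ℕ) (1 : ℂ)) = 1 := rfl
    rw [h1, map_one Φ, map_one (UniversalEnvelopingAlgebra.lift ℂ _), Finsupp.mapDomain_zero]
    exact SameLeading.one
  | succ d ih =>
    have hs0 : s ≠ 0 := by rintro rfl; simp at hd
    obtain ⟨b, hb⟩ := Finsupp.support_nonempty_iff.2 hs0
    have hlt := degree_sub_single_add_one hb
    have h1 := ih (s - Finsupp.single b 1) (by omega)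
    have hm : (MvPolynomial.monomial s (1 : ℂ)) =
        MvPolynomial.X b * MvPolynomial.monomial (s - Finsupp.single b 1) 1 := by
      rw [MvPolynomial.X, MvPolynomial.monomial_mul, add_comm, sub_single_add_single hb, one_mul]
    have hm' : (MvPolynomial.monomial (s.mapDomain e) (1 : ℂ)) = MvPolynomial.X (e b) *
        MvPolynomial.monomial ((s - Finsupp.single b 1).mapDomain e) 1 := by
      conv_lhs => rw [← sub_single_add_single hb, Finsupp.mapDomain_add, Finsupp.mapDomain_single]
      rw [MvPolynomial.X, MvPolynomial.monomial_mul, add_comm, one_mul]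
    rw [hm, map_mul, map_mul, hΦ, UniversalEnvelopingAlgebra.lift_ι_apply, Module.End.mul_apply,
      affineAction_apply, he, linForm_basis, hm']
    have h2 := (SameLeading.refl (d := 1) (X_mem_lowDegree (e b))).mul h1
    rw [add_comm 1 d] at h2
    refine ⟨?_, h2.right_mem⟩
    rw [add_sub_assoc]
    exact add_mem (adDerivation_mem_lowDegree β _ h1.left_mem) h2.sub_mem

/-- Commuting elements `z s` of a Lie algebra such that the elements `⁅z s, w⁆` are linearly
independent are algebraically independent in the enveloping algebra. -/
theorem injective_of_linearIndependent_lie {w : L} {z : σ → L}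
    (hz : LinearIndependent ℂ fun s => ⁅z s, w⁆)
    (Φ : MvPolynomial σ ℂ →ₐ[ℂ] UniversalEnvelopingAlgebra ℂ L)
    (hΦ : ∀ s, Φ (MvPolynomial.X s) = UniversalEnvelopingAlgebra.ι ℂ (z s)) :
    Function.Injective Φ := by
  -- Completing the ⁅z s, w⁆ to a basis of `L` turns them into distinct variables of the symmetric
  -- algebra.
  let β := Module.Basis.sumExtend hz
  have he : ∀ s, ⁅z s, w⁆ = β (Sum.inl s) := fun s => by
    simp [β, Module.Basis.sumExtend]
    rfl
  let T : MvPolynomial σ ℂ →ₗ[ℂ] MvPolynomial _ ℂ :=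
    (LinearMap.applyₗ (1 : MvPolynomial _ ℂ)) ∘ₗ
      ((UniversalEnvelopingAlgebra.lift ℂ (affineAction β w)).comp Φ).toLinearMap
  have hli : LinearIndependent ℂ fun s : σ →₀ ℕ => T (MvPolynomial.monomial s 1) := by
    refine linearIndependent_of_sameLeading (e := fun s => s.mapDomain Sum.inl)
      (Finsupp.mapDomain_injective Sum.inl_injective) (a := fun _ => 1)
      (fun _ => one_ne_zero) fun s => ?_
    rw [Finsupp.degree_mapDomain]
    exact sameLeading_affineAction β he Φ hΦ s
  rw [injective_iff_map_eq_zero]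
  intro f hf
  have hT : T f = 0 := by
    change UniversalEnvelopingAlgebra.lift ℂ (affineAction β w) (Φ f) 1 = 0
    rw [hf, map_zero, LinearMap.zero_apply]
  have h2 := linearIndependent_iff.1 hli ((MvPolynomial.basisMonomials σ ℂ).repr f) (by
    have h3 := congrArg T ((MvPolynomial.basisMonomials σ ℂ).linearCombination_repr f)
    rw [hT, Finsupp.apply_linearCombination] at h3
    simpa [Function.comp_def] using h3)
  exact (LinearEquiv.map_eq_zero_iff _).1 h2

/-- A family of commuting elements extends to a homomorphism from the polynomial ring. -/
theorem exists_algHom_of_commute {S : Type*} [Ring S] [Algebra ℂ S] {f : σ → S}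
    (hf : ∀ s t, f s * f t = f t * f s) :
    ∃ Φ : MvPolynomial σ ℂ →ₐ[ℂ] S, ∀ s, Φ (MvPolynomial.X s) = f s := by
  have hcomm : ∀ a ∈ Set.range f, ∀ b ∈ Set.range f, a * b = b * a := by
    rintro _ ⟨s, rfl⟩ _ ⟨t, rfl⟩
    exact hf s t
  -- Evaluation of polynomials needs a commutative target, so it is done in the subalgebra generated
  -- by the family.
  let _ : CommRing (Algebra.adjoin ℂ (Set.range f)) :=
    { (inferInstance : Ring (Algebra.adjoin ℂ (Set.range f))) with
      mul_comm := (Algebra.isMulCommutative_adjoin ℂ hcomm).is_comm.comm }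
  refine ⟨(Algebra.adjoin ℂ (Set.range f)).val.comp
    (MvPolynomial.aeval fun s => ⟨f s, Algebra.subset_adjoin ⟨s, rfl⟩⟩), fun s => ?_⟩
  rw [AlgHom.comp_apply, MvPolynomial.aeval_X]
  rfl

end Commuting

/-! ### The recursion for `p(χ)` -/

section PRecursion

variable {A : Type*} [CommRing A] [Algebra ℂ A]

theorem p2_eq_zero {φ χ : A →₀ ℕ} (h : φ.degree ≠ χ.degree) : p2 φ χ = 0 := by
  rw [p2, if_neg, if_neg h]
  rintro ⟨rfl, rfl⟩
  exact h rfl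

/-- Since `p2` vanishes on unequal degrees, only ψ₂ = |ψ| χ₁ survives, and for it m and π are both
1. This reduces the double recursion to the exponential one. -/
theorem sum_p2_sub {φ ψ : A →₀ ℕ} (hψ : ψ ≤ φ) (h0 : ψ ≠ 0) :
    ∑ ψ₂ ∈ (Finset.Icc 0 (Finsupp.single (1 : A) φ.degree)).erase 0,
      ((ψ.multinomial : ℂ) * (ψ₂.multinomial : ℂ)) •
        (elt sl2h (mprod ψ * mprod ψ₂) * p2 (φ - ψ) (Finsupp.single 1 φ.degree - ψ₂)) =
      (ψ.multinomial : ℂ) • (elt sl2h (mprod ψ) * p1 (φ - ψ)) := by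
  have hdeg : (φ - ψ).degree + ψ.degree = φ.degree := by
    rw [← map_add, tsub_add_cancel_of_le hψ]
  have hd0 : ψ.degree ≠ 0 := fun h => h0 ((Finsupp.degree_eq_zero_iff _).1 h)
  have hsub : Finsupp.single (1 : A) φ.degree - Finsupp.single 1 ψ.degree =
      Finsupp.single 1 (φ - ψ).degree := by
    rw [← Finsupp.single_tsub, ← hdeg, Nat.add_sub_cancel]
  rw [Finset.sum_eq_single_of_mem (Finsupp.single 1 ψ.degree)]
  · have h1 : (Finsupp.single (1 : A) ψ.degree).multinomial = 1 := by
      simp [Finsupp.multinomial_eq, hd0]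
    have h2 : mprod (Finsupp.single (1 : A) ψ.degree) = 1 := by
      simp [mprod]
    rw [h1, h2, hsub, mul_one, Nat.cast_one, mul_one, p1]
  · rw [Finset.mem_erase, Finset.mem_Icc]
    exact ⟨by simpa using hd0, zero_le, Finsupp.single_mono (by omega)⟩
  · intro ψ₂ h2 hne
    rw [Finset.mem_erase, Finset.mem_Icc] at h2
    have h3 : (Finsupp.single (1 : A) φ.degree - ψ₂).degree + ψ₂.degree = φ.degree := by
      rw [← map_add, tsub_add_cancel_of_le h2.2.2, Finsupp.degree_single]
    rw [p2_eq_zero, mul_zero, smul_zero]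
    intro h
    apply hne
    have h4 : ψ₂ = Finsupp.single 1 (ψ₂ 1) := by
      ext a
      by_cases ha : (1 : A) = a
      · subst ha; simp
      · have := h2.2.2 a
        rw [Finsupp.single_eq_of_ne' ha] at this ⊢
        omega
    have h5 : ψ₂.degree = ψ₂ 1 := by
      conv_lhs => rw [h4, Finsupp.degree_single]
    rw [h4, ← h5]
    congr 1
    omega

theorem isExpFamily_p1 : IsExpFamily (fun ψ : A →₀ ℕ =>
    if ψ = 0 then 0 else (ψ.multinomial : ℂ) • elt sl2h (mprod ψ)) p1 where
  zero := by rw [p1, p2, if_pos]; simp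
  degree_smul φ := by
    by_cases h0 : φ = 0
    · subst h0; simp
    have hd : (φ.degree : ℂ) ≠ 0 :=
      Nat.cast_ne_zero.2 fun h => h0 ((Finsupp.degree_eq_zero_iff _).1 h)
    rw [p1, p2, if_neg (fun h => h0 h.1), if_pos (Finsupp.degree_single _ _).symm, smul_smul,
      mul_neg, mul_inv_cancel₀ hd, neg_smul, one_smul]
    congr 1
    rw [Finset.sum_attach ((Finset.Icc 0 φ).erase 0) fun ψ₁ =>
      ∑ ψ₂ ∈ (Finset.Icc 0 (Finsupp.single (1 : A) φ.degree)).erase 0,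
      ((ψ₁.multinomial : ℂ) * (ψ₂.multinomial : ℂ)) •
        (elt sl2h (mprod ψ₁ * mprod ψ₂) * p2 (φ - ψ₁) (Finsupp.single 1 φ.degree - ψ₂))]
    simp only [ite_mul, zero_mul]
    rw [Finset.sum_ite, Finset.sum_const_zero, zero_add]
    refine Finset.sum_bij (fun ψ _ => (ψ, φ - ψ)) ?_ ?_ ?_ ?_
    · intro ψ hψ
      rw [Finset.mem_erase, Finset.mem_Icc] at hψ
      rw [Finset.mem_filter, mem_antidiagonal]
      exact ⟨add_tsub_cancel_of_le hψ.2.2, hψ.1⟩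
    · intro a _ b _ h
      exact (Prod.ext_iff.1 h).1
    · rintro ⟨ψ, ρ⟩ h
      rw [Finset.mem_filter, mem_antidiagonal] at h
      obtain ⟨rfl, h1⟩ := h
      exact ⟨ψ, Finset.mem_erase.2 ⟨h1, by simp⟩, by simp⟩
    · intro ψ hψ
      rw [Finset.mem_erase, Finset.mem_Icc] at hψ
      rw [sum_p2_sub hψ.2.2 hψ.1, smul_mul_assoc]

end PRecursion

/-! ### Multisets of basis elements -/

theorem sum_antidiagonal_embDomain {σ τ S : Type*} [AddCommMonoid S] (e : σ ↪ τ) (χ : σ →₀ ℕ)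
    (f : (τ →₀ ℕ) → (τ →₀ ℕ) → S) :
    ∑ x ∈ antidiagonal (χ.embDomain e), f x.1 x.2 =
      ∑ x ∈ antidiagonal χ, f (x.1.embDomain e) (x.2.embDomain e) := by
  rw [← Finsupp.image_prodMap_embDomain_antidiagonal, Finset.sum_image]
  · rfl
  · intro x _ y _ h
    exact ((Finsupp.embDomain_injective e).prodMap (Finsupp.embDomain_injective e)) h

section BasisLetters

variable {A : Type*} {B : Set A}

/-- The semigroup formed by a subset closed under multiplication. -/
abbrev semigroupOfMulMem [CommRing A] (hB : ∀ a ∈ B, ∀ c ∈ B, a * c ∈ B) : CommSemigroup B where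
  mul a c := ⟨a * c, hB a a.2 c c.2⟩
  mul_assoc a c d := Subtype.ext (mul_assoc (a : A) c d)
  mul_comm a c := Subtype.ext (mul_comm (a : A) c)

theorem toA_eq_zero {ψ : B →₀ ℕ} : toA ψ = 0 ↔ ψ = 0 := Finsupp.embDomain_eq_zero

theorem multinomial_toA (ψ : B →₀ ℕ) : (toA ψ).multinomial = ψ.multinomial := by
  rw [Finsupp.multinomial, toA, Finsupp.sum_embDomain, Finsupp.prod_embDomain]
  rfl

theorem degree_toA (ψ : B →₀ ℕ) : (toA ψ).degree = ψ.degree := by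
  rw [toA, Finsupp.embDomain_eq_mapDomain, Finsupp.degree_mapDomain]

variable [CommRing A] [CommSemigroup B]

/-- The product in `A` of a word in `B`. -/
def letterVal (hmul : ∀ a c : B, ((a * c : B) : A) = a * c) : WithOne B →* A :=
  WithOne.lift ⟨Subtype.val, hmul⟩

theorem letterVal_coe (hmul : ∀ a c : B, ((a * c : B) : A) = a * c) (b : B) :
    letterVal hmul b = b := rfl

theorem mprod_toA (hmul : ∀ a c : B, ((a * c : B) : A) = a * c) (ψ : B →₀ ℕ) :
    mprod (toA ψ) = letterVal hmul (letterProd ψ) := by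
  rw [mprod, toA, Finsupp.prod_embDomain, letterProd, map_finsuppProd]
  simp only [map_pow, letterVal_coe]
  rfl

theorem isExpFamily_p1_toA [Algebra ℂ A] (hmul : ∀ a c : B, ((a * c : B) : A) = a * c) :
    IsExpFamily (letterCoeff fun m : WithOne B => elt sl2h (letterVal hmul m))
      (fun χ : B →₀ ℕ => p1 (toA χ)) where
  zero := (congrArg p1 (toA_eq_zero.2 rfl)).trans isExpFamily_p1.zero
  degree_smul χ := by
    have h := isExpFamily_p1.degree_smul (toA χ)
    rw [degree_toA, toA, sum_antidiagonal_embDomain (Function.Embedding.subtype _) χ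
      fun ψ ρ => (if ψ = 0 then 0 else (ψ.multinomial : ℂ) • elt sl2h (mprod ψ)) * p1 ρ] at h
    refine h.trans (congrArg Neg.neg (Finset.sum_congr rfl fun x _ => ?_))
    congr 1
    change (if toA x.1 = 0 then 0 else
      ((toA x.1).multinomial : ℂ) • elt sl2h (mprod (toA x.1))) = _
    rw [letterCoeff]
    simp only [toA_eq_zero, multinomial_toA, mprod_toA hmul]
    split_ifs
    · rfl
    · rw [Algebra.smul_def, map_natCast]

end BasisLetters

/-! ### The images in `U(𝔤 ⊗ A)` -/

theorem sl2Hom_sl2h {𝔤 : Type*} [LieRing 𝔤] [LieAlgebra ℂ 𝔤] {h e f : 𝔤}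
    (t : IsSl2Triple h e f) : sl2Hom t sl2h = h := by
  change sl2h.1 0 0 • h + sl2h.1 0 1 • e + sl2h.1 1 0 • f = h
  simp [sl2h]

theorem omegaOfTriple_elt {A 𝔤 : Type*} [CommRing A] [Algebra ℂ A] [LieRing 𝔤] [LieAlgebra ℂ 𝔤]
    {h e f : 𝔤} (t : IsSl2Triple h e f) (a : A) :
    omegaOfTriple A t (elt sl2h a) = elt h a := by
  rw [omegaOfTriple, elt, UniversalEnvelopingAlgebra.lift_ι_apply, LieHom.comp_apply,
    LieAlgebra.ExtendScalars.map_apply_tmul, sl2Hom_sl2h]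
  rfl

/-! ### Coroots and root vectors of the simple Lie algebra -/

section Simple

open LieAlgebra LieAlgebra.IsKilling LieModule

variable {𝔤 : Type*} [LieRing 𝔤] [LieAlgebra ℂ 𝔤] [FiniteDimensional ℂ 𝔤] [IsSimple ℂ 𝔤]
  {H : LieSubalgebra ℂ 𝔤} [H.IsCartanSubalgebra] {x : H.root → 𝔤}
  {A : Type*} [CommRing A] [Algebra ℂ A] {B : Set A}

theorem isExpFamily_pRoot [CommSemigroup B] (hmul : ∀ a c : B, ((a * c : B) : A) = a * c)
    (hx : IsChevalleyBasis x) (α : H.root) :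
    IsExpFamily (letterCoeff fun m : WithOne B =>
        elt ((coroot α.1 : H) : 𝔤) (letterVal hmul m))
      (fun χ : B →₀ ℕ => pRoot hx α (toA χ)) := by
  have h := (isExpFamily_p1_toA hmul).map (omega A hx α)
  have hc : (fun ψ : B →₀ ℕ => omega A hx α
      (letterCoeff (fun m : WithOne B => elt sl2h (letterVal hmul m)) ψ)) =
      letterCoeff fun m : WithOne B => elt ((coroot α.1 : H) : 𝔤) (letterVal hmul m) := by
    funext ψ
    rw [letterCoeff, letterCoeff]
    split_ifs
    · exact map_zero _
    · rw [map_mul, map_natCast, omega, omegaOfTriple_elt]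
  rw [hc] at h
  exact h

theorem elt_mul_elt_comm (h h' : H) (a c : A) :
    elt (h : 𝔤) a * elt (h' : 𝔤) c = elt (h' : 𝔤) c * elt (h : 𝔤) a := by
  have h1 : ⁅(h : 𝔤), (h' : 𝔤)⁆ = 0 := by
    rw [← LieSubalgebra.coe_bracket, trivial_lie_zero, ZeroMemClass.coe_zero]
  rw [← sub_eq_zero, ← LieRing.of_associative_ring_bracket, elt, elt, ← LieHom.map_lie,
    ExtendScalars.bracket_tmul, h1, TensorProduct.tmul_zero]
  exact map_zero (UniversalEnvelopingAlgebra.ι ℂ)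

theorem linearIndependent_rootVectors (hx : IsChevalleyBasis x) : LinearIndependent ℂ x := by
  have h := (iSupIndep_genWeightSpace ℂ H 𝔤).comp
    (f := fun α : H.root => (α.1 : H → ℂ)) fun α β h =>
      Subtype.ext (DFunLike.coe_injective h)
  rw [← LieSubmodule.iSupIndep_toSubmodule] at h
  exact h.linearIndependent _ hx.mem_rootSpace fun α => (hx.isSl2Triple α).e_ne_zero

theorem lie_sum_rootVectors (hx : IsChevalleyBasis x) (s : Finset H.root) (h : H) :
    ⁅(h : 𝔤), ∑ α ∈ s, x α⁆ = ∑ α ∈ s, α.1 h • x α := by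
  rw [lie_sum]
  exact Finset.sum_congr rfl fun α _ => lie_eq_smul_of_mem_rootSpace (hx.mem_rootSpace α) h

/-- The bracket is ∑ α(h) x_α, and the root vectors are independent, so every simple root kills h;
the simple roots span the dual of `H`. -/
theorem eq_zero_of_lie_sum_eq_zero (hx : IsChevalleyBasis x) (b : (rootSystem H).Base) {h : H}
    (h0 : ⁅(h : 𝔤), ∑ α ∈ b.support, x α⁆ = 0) : h = 0 := by
  rw [lie_sum_rootVectors hx] at h0
  have h1 := linearIndependent_iff'.1 (linearIndependent_rootVectors hx) _ _ h0
  rw [← Module.forall_dual_apply_eq_zero_iff ℂ]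
  intro f
  have hf : f ∈ Submodule.span ℂ ((rootSystem H).root '' b.support) := by
    rw [b.span_root_support, RootPairing.rootSpan, RootPairing.IsRootSystem.span_root_eq_top]
    trivial
  induction hf using Submodule.span_induction with
  | mem f hf =>
    obtain ⟨α, hα, rfl⟩ := hf
    exact h1 α hα
  | zero => rfl
  | add f g _ _ hf hg => rw [LinearMap.add_apply, hf, hg, add_zero]
  | smul c f _ hf => rw [LinearMap.smul_apply, hf, smul_zero]

theorem linearIndependent_lie_sum (hx : IsChevalleyBasis x) (b : (rootSystem H).Base) :
    LinearIndependent ℂ fun α : b.support =>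
      ⁅((coroot α.1.1 : H) : 𝔤), ∑ β ∈ b.support, x β⁆ := by
  have hli : LinearIndependent ℂ fun α : b.support => (coroot α.1.1 : H) :=
    b.linearIndepOn_coroot
  let T : H →ₗ[ℂ] 𝔤 := ((toEnd ℂ 𝔤 𝔤).toLinearMap.flip (∑ β ∈ b.support, x β)).comp
    H.toSubmodule.subtype
  refine hli.map' T (LinearMap.ker_eq_bot'.2 fun h h0 => ?_)
  exact eq_zero_of_lie_sum_eq_zero hx b h0

end Simple

end Auxiliary

/-! ### The basis of `U⁰_ℤ(𝔤 ⊗ A)` -/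

section Main

open LieAlgebra LieAlgebra.IsKilling LieModule

variable {𝔤 : Type*} [LieRing 𝔤] [LieAlgebra ℂ 𝔤] [FiniteDimensional ℂ 𝔤] [IsSimple ℂ 𝔤]
  {H : LieSubalgebra ℂ 𝔤} [H.IsCartanSubalgebra] {x : H.root → 𝔤}
  {A : Type*} [CommRing A] [Algebra ℂ A] {B : Set A} {n : ℕ}

/-- Both families solve the exponential recursion with coefficients m(ψ) (h_i ⊗ π(ψ)), so uniqueness
applies. -/
theorem map_colourP_eq_pRoot [CommSemigroup B] (hmul : ∀ a c : B, ((a * c : B) : A) = a * c)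
    (hx : IsChevalleyBasis x) (α : Fin n → H.root)
    {Φ : MvPolynomial (Fin n × B) ℂ →ₐ[ℂ] UniversalEnvelopingAlgebra ℂ (A ⊗[ℂ] 𝔤)}
    (hΦ : ∀ s, Φ (MvPolynomial.X s) = elt ((coroot (α s.1).1 : H) : 𝔤) (s.2 : A))
    (i : Fin n) (χ : B →₀ ℕ) : Φ (colourP i χ) = pRoot hx (α i) (toA χ) := by
  have h1 := (isExpFamily_univP (σ := B)).map (Φ.comp (MvPolynomial.rename (Prod.mk i)))
  have h2 := isExpFamily_pRoot hmul hx (α i)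
  have hc : (fun ψ : B →₀ ℕ => Φ.comp (MvPolynomial.rename (Prod.mk i))
      (letterCoeff letterVar ψ)) = letterCoeff fun m : WithOne B =>
        elt ((coroot (α i).1 : H) : 𝔤) (letterVal hmul m) := by
    funext ψ
    rw [letterCoeff, letterCoeff]
    split_ifs with h0
    · exact map_zero _
    · obtain ⟨b, hb⟩ := WithOne.ne_one_iff_exists.1 (letterProd_ne_one h0)
      rw [← hb, letterVar_coe, map_mul, map_natCast, AlgHom.comp_apply, MvPolynomial.rename_X, hΦ,
        letterVal_coe]
  rw [hc] at h1
  exact h1.unique (letterCoeff_zero _) h2 χ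

theorem map_colourProd_eq_f0 [CommSemigroup B] (hmul : ∀ a c : B, ((a * c : B) : A) = a * c)
    (hx : IsChevalleyBasis x) (α : Fin n → H.root)
    {Φ : MvPolynomial (Fin n × B) ℂ →ₐ[ℂ] UniversalEnvelopingAlgebra ℂ (A ⊗[ℂ] 𝔤)}
    (hΦ : ∀ s, Φ (MvPolynomial.X s) = elt ((coroot (α s.1).1 : H) : 𝔤) (s.2 : A))
    (ψ : Fin n → B →₀ ℕ) : Φ (colourProd ψ) = f0 hx α B ψ := by
  rw [colourProd, ← List.prod_ofFn, map_list_prod, List.map_ofFn, f0]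
  congr 2
  funext i
  exact map_colourP_eq_pRoot hmul hx α hΦ i (ψ i)

theorem UZero_toSubmodule_eq_span [CommSemigroup B]
    (hmul : ∀ a c : B, ((a * c : B) : A) = a * c) (hx : IsChevalleyBasis x) (α : Fin n → H.root)
    {Φ : MvPolynomial (Fin n × B) ℂ →ₐ[ℂ] UniversalEnvelopingAlgebra ℂ (A ⊗[ℂ] 𝔤)}
    (hΦ : ∀ s, Φ (MvPolynomial.X s) = elt ((coroot (α s.1).1 : H) : 𝔤) (s.2 : A)) :
    (UZero hx α B).toSubmodule = Submodule.span ℤ (Set.range (f0 hx α B)) := by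
  let Ψ : MvPolynomial (Fin n × B) ℂ →ₐ[ℤ] UniversalEnvelopingAlgebra ℂ (A ⊗[ℂ] 𝔤) :=
    Φ.restrictScalars ℤ
  have h1 : UZero hx α B = (Algebra.adjoin ℤ
      {f : MvPolynomial (Fin n × B) ℂ | ∃ i χ, f = colourP i χ}).map Ψ := by
    rw [AlgHom.map_adjoin, UZero]
    congr 1
    ext u
    constructor
    · rintro ⟨i, χ, rfl⟩
      exact ⟨_, ⟨i, χ, rfl⟩, map_colourP_eq_pRoot hmul hx α hΦ i χ⟩
    · rintro ⟨_, ⟨i, χ, rfl⟩, rfl⟩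
      exact ⟨i, χ, map_colourP_eq_pRoot hmul hx α hΦ i χ⟩
  rw [h1, Subalgebra.map_toSubmodule, adjoin_colourP_eq_span, Submodule.map_span, ← Set.range_comp]
  congr 2
  funext ψ
  exact map_colourProd_eq_f0 hmul hx α hΦ ψ

theorem linearIndependent_tmul_lie_sum (hx : IsChevalleyBasis x) (b : (rootSystem H).Base)
    (α : Fin n ≃ b.support) (hB : LinearIndependent ℂ (fun a : B => (a : A))) :
    LinearIndependent ℂ fun s : Fin n × B => ⁅(s.2 : A) ⊗ₜ[ℂ] ((coroot (α s.1).1.1 : H) : 𝔤),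
        (1 : A) ⊗ₜ[ℂ] ∑ β ∈ b.support, x β⁆ := by
  -- Pure tensors of two independent families are independent; the swap only matches the order of
  -- the indices.
  have h := (hB.tmul_of_isDomain ((linearIndependent_lie_sum hx b).comp α α.injective)).comp
    Prod.swap Prod.swap_injective
  have e : (fun s : Fin n × B => ⁅(s.2 : A) ⊗ₜ[ℂ] ((coroot (α s.1).1.1 : H) : 𝔤),
      (1 : A) ⊗ₜ[ℂ] ∑ β ∈ b.support, x β⁆) = fun s : Fin n × B =>
        (s.2 : A) ⊗ₜ[ℂ] ⁅((coroot (α s.1).1.1 : H) : 𝔤), ∑ β ∈ b.support, x β⁆ := by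
    funext s
    rw [ExtendScalars.bracket_tmul, mul_one]
  rw [e]
  exact h

theorem linearIndependent_f0 [CommSemigroup B] (hmul : ∀ a c : B, ((a * c : B) : A) = a * c)
    (hx : IsChevalleyBasis x) (b : (rootSystem H).Base) (α : Fin n ≃ b.support)
    (hB : LinearIndependent ℂ (fun a : B => (a : A)))
    {Φ : MvPolynomial (Fin n × B) ℂ →ₐ[ℂ] UniversalEnvelopingAlgebra ℂ (A ⊗[ℂ] 𝔤)}
    (hΦ : ∀ s, Φ (MvPolynomial.X s) = elt ((coroot (α s.1).1.1 : H) : 𝔤) (s.2 : A)) :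
    LinearIndependent ℂ (f0 hx (fun i => (α i).1) B) := by
  have hinj : Function.Injective Φ :=
    injective_of_linearIndependent_lie (w := (1 : A) ⊗ₜ[ℂ] ∑ β ∈ b.support, x β)
      (z := fun s : Fin n × B => (s.2 : A) ⊗ₜ[ℂ] ((coroot (α s.1).1.1 : H) : 𝔤))
      (linearIndependent_tmul_lie_sum hx b α hB) Φ hΦ
  have e : f0 hx (fun i => (α i).1) B = fun ψ => Φ (colourProd ψ) := by
    funext ψ
    exact (map_colourProd_eq_f0 hmul hx (fun i => (α i).1) hΦ ψ).symm
  rw [e]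
  exact linearIndependent_colourProd.map' Φ.toLinearMap (LinearMap.ker_eq_bot.2 hinj)

end Main

end MapAlgebra

end

theorem mainTheorem7
    -- a finite-dimensional simple complex Lie algebra with a Cartan subalgebra
    {𝔤 : Type*} [LieRing 𝔤] [LieAlgebra ℂ 𝔤] [FiniteDimensional ℂ 𝔤] [LieAlgebra.IsSimple ℂ 𝔤]
    {H : LieSubalgebra ℂ 𝔤} [H.IsCartanSubalgebra]
    -- the simple roots, numbered by `1, …, n`, and a Chevalley basis
    (b : (LieAlgebra.IsKilling.rootSystem H).Base) {n : ℕ} (α : Fin n ≃ b.support)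
    {x : H.root → 𝔤} (hx : MapAlgebra.IsChevalleyBasis x)
    -- a commutative algebra with a basis closed under multiplication
    {A : Type*} [CommRing A] [Algebra ℂ A] (B : Set A)
    (hB_lin : LinearIndependent ℂ (fun a : B => (a : A))) (hB_span : Submodule.span ℂ B = ⊤)
    (hB_mul : ∀ a ∈ B, ∀ c ∈ B, a * c ∈ B) :
    ∃ β : Module.Basis (Fin n → (B →₀ ℕ)) ℤ (MapAlgebra.UZero hx (fun i => (α i).1) B),
      ∀ ψ : Fin n → (B →₀ ℕ),
        (β ψ : UniversalEnvelopingAlgebra ℂ (TensorProduct ℂ A 𝔤)) =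
          MapAlgebra.f0 hx (fun i => (α i).1) B ψ := by
  let _ : CommSemigroup B := MapAlgebra.semigroupOfMulMem hB_mul
  have hmul : ∀ a c : B, ((a * c : B) : A) = a * c := fun _ _ => rfl
  obtain ⟨Φ, hΦ⟩ := MapAlgebra.exists_algHom_of_commute
    (f := fun s : Fin n × B => MapAlgebra.elt
      ((LieAlgebra.IsKilling.coroot (α s.1).1.1 : H) : 𝔤) (s.2 : A))
    fun s t => MapAlgebra.elt_mul_elt_comm _ _ _ _
  -- Independence over ℂ restricts to ℤ because ℤ embeds in ℂ; the spanning statement then makes the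
  -- family a basis.
  have hli : LinearIndependent ℤ (MapAlgebra.f0 hx (fun i => (α i).1) B) :=
    (MapAlgebra.linearIndependent_f0 hmul hx b α hB_lin hΦ).restrict_scalars
      (by intro m k h; simpa using h)
  have hspan := MapAlgebra.UZero_toSubmodule_eq_span hmul hx (fun i => (α i).1) hΦ
  refine ⟨((Module.Basis.span hli).map (LinearEquiv.ofEq _ _ hspan.symm)).map
    (Subalgebra.toSubmoduleEquiv _), fun ψ => ?_⟩
  exact congrArg Subtype.val (Module.Basis.span_apply hli ψ)
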